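/- Let $n,k\ge 1$. For a group $W$ generated by a set $T$, let $\ell_T$ be the word length and let $\pi\le_T\mu$ mean $\ell_T(\mu)=\ell_T(\pi)+\ell_T(\pi^{-1}\mu)$; for $c\in W$ put $NC(W)=\{w: 1\le_T w\le_T c\}$, ordered by $\le_T$. Let $NC^{(k)}(W)$ be the set of $k$-multichains $(\pi)_k=(\pi_1\le_T\cdots\le_T\pi_k)$ in $NC(W)$, ordered by $(\pi)_k\le(\mu)_k$ iff $\mu_i^{-1}\mu_{i+1}\le_T\pi_i^{-1}\pi_{i+1}$ for all $1\le i\le k$, where $\pi_{k+1}=\mu_{k+1}=c$. Let $A_{N-1}$ be the symmetric group on $[N]=\{1,\dots,N\}$, with $T$ the set of transpositions and $c=(1\,2\cdots N)$. Identify $[\pm n]=\{1,\dots,n,-1,\dots,-n\}$ with $[2n]$ by $-i\leftrightarrow n+i$. Let $B_n\subset A_{2n-1}$ be the group of permutations of $[\pm n]$ commuting with $i\mapsto -i$, with $T$ the set of the permutations $(i,-i)$ and $(i,j)(-i,-j)$, $j\ne\pm i$, and with $c=(1,2,\dots,n,-1,\dots,-n)=(1\,2\cdots 2n)$. A partition of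 a finite linearly ordered set is noncrossing if there are no $a<b<c<d$ with $a,c$ in one block and $b,d$ in another; partitions are ordered by refinement. For partitions $\mathcal Q_1,\dots,\mathcal Q_k$ of $[N]$ let $\langle\mathcal Q_1,\dots,\mathcal Q_k\rangle$ be the partition of $[kN]$ that is the union of the translated dilations $k\mathcal Q_i-(k-i)$. The Kreweras complement $K(\mathcal P)$ of a noncrossing $\mathcal P$ is the coarsest $\mathcal Q$ with $\langle\mathcal P,\mathcal Q\rangle$ noncrossing (after relabelling the underlying set by $1,2,\dots$ in increasing order); $K$ is a bijection on noncrossing partitions. For $\mathcal P\le\mathcal R$ let $K^{\mathcal R}(\mathcal P)$ be the union, over the blocks $U$ of $\mathcal R$, of the Kreweras complements in $U$ of the restrictions $\mathcal P|U$. For a permutation $\pi$ let $\{\pi\}$ be its partition into orbits. The type $A$ map sends $(\pi)_k\in NC^{(k)}(A_{N-1})$ to $$K^{-1}\Big\langle K^{\{\pi_2\}}(\{\pi_1\}),\dots,K^{\{\pi_k\}}(\{\pi_{k-1}\}),K(\{\pi_k\})\Big\rangle .$$ **Theorem.** The inclusion $B_n\subset A_{2n-1}$ identifies $NC(B_n)$,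 with its order, with the sublattice of $NC(A_{2n-1})$ of elements fixed under conjugation by $c^n$, and correspondingly identifies $NC^{(k)}(B_n)$ with the induced subposet of $NC^{(k)}(A_{2n-1})$ of the multichains with all entries in this sublattice. The restriction of the type $A$ map (with $N=2n$) to $NC^{(k)}(B_n)$ is well defined (the partition to which $K^{-1}$ is applied is noncrossing) and is an isomorphism of posets from $NC^{(k)}(B_n)$ onto the set, ordered by refinement, of the noncrossing partitions of $[\pm kn]\cong[2kn]$ that are invariant under the antipodal map $x\mapsto x+kn \pmod{2kn}$ and all of whose blocks have cardinality divisible by $k$. -/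

import Mathlib

namespace KDiv

/-! ### Absolute order, algebraic (`k`-divisible) noncrossing partitions -/

section Algebraic

variable {G : Type*} [Group G]

/-- The word length `ℓ_T(w)`: least length of a word in the letters `T` with product `w`. -/
noncomputable def wordLength (T : Set G) (w : G) : ℕ :=
  sInf {r : ℕ | ∃ l : List G, (∀ t ∈ l, t ∈ T) ∧ l.length = r ∧ l.prod = w}

/-- The absolute order: `π ≤_T μ` iff `ℓ_T(μ) = ℓ_T(π) + ℓ_T(π⁻¹ μ)`. -/
def AbsLE (T : Set G) (π μ : G) : Prop :=
  wordLength T μ = wordLength T π + wordLength T (π⁻¹ * μ)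

/-- The poset `NC(W, c)`: the interval `[1, c]` in the absolute order. -/
def NCGroup (T : Set G) (c : G) : Type _ := {w : G // AbsLE T 1 w ∧ AbsLE T w c}

/-- The order of `NC(W, c)` is the absolute order. -/
instance (T : Set G) (c : G) : LE (NCGroup T c) := ⟨fun u v => AbsLE T u.1 v.1⟩

/-- The `k`-multichains `π₁ ≤ π₂ ≤ ⋯ ≤ π_k` in `NC(W, c)`: the underlying set of `NC^{(k)}(W)`. -/
def NCGroupDiv (T : Set G) (c : G) (k : ℕ) : Type _ :=
  {π : Fin k → NCGroup T c // ∀ i j : Fin k, i ≤ j → π i ≤ π j}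

/-- The delta sequence `∂(π)_k = (π₁⁻¹ π₂, …, π_{k-1}⁻¹ π_k, π_k⁻¹ c)` of a multichain. -/
def delta {T : Set G} {c : G} {k : ℕ} (π : NCGroupDiv T c k) (i : Fin k) : G :=
  (π.1 i).1⁻¹ * (if h : (i : ℕ) + 1 < k then (π.1 ⟨i + 1, h⟩).1 else c)

/-- The order of `NC^{(k)}(W)`: `π ≤ μ` iff `∂μ ≤_T ∂π` componentwise. -/
instance (T : Set G) (c : G) (k : ℕ) : LE (NCGroupDiv T c k) :=
  ⟨fun π μ => ∀ i : Fin k, AbsLE T (delta μ i) (delta π i)⟩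

end Algebraic

/-! ### The symmetric group `A_{N-1}` and the group `B_n` of signed permutations -/

/-- The `N`-cycle `(1 2 ⋯ N)` on `[N]`; the point `i` of `Fin N` stands for `i + 1 ∈ [N]`. -/
def cyc (N : ℕ) : Equiv.Perm (Fin N) := finRotate N

/-- The reflections of the symmetric group: the transpositions. -/
def reflA (N : ℕ) : Set (Equiv.Perm (Fin N)) := {t | t.IsSwap}

/-- The half-turn of the `N`-gon, for even `N`. For `N = 2 * n` we label the points
`1, 2, …, n, -1, -2, …, -n` in this order, so that `[2n]` becomes `[±n]` and the half-turn is the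
antipodal permutation `i ↦ -i`. -/
def antipode (N : ℕ) : Equiv.Perm (Fin N) := finRotate N ^ (N / 2)

/-- `B_n`: the permutations of `[±n]` that commute with the antipodal permutation. -/
def signedPerm (n : ℕ) : Subgroup (Equiv.Perm (Fin (2 * n))) :=
  Subgroup.centralizer {antipode (2 * n)}

/-- The reflections of `B_n`: the permutations `(i, -i)`, and `(i, j)(-i, -j)` with `j ≠ ±i`. -/
def reflB (n : ℕ) : Set (signedPerm n) :=
  {t | (∃ i, t.1 = Equiv.swap i (antipode _ i)) ∨
    ∃ i j, j ≠ i ∧ j ≠ antipode _ i ∧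
      t.1 = Equiv.swap i j * Equiv.swap (antipode _ i) (antipode _ j)}

/-- The Coxeter element `(1, 2, …, n, -1, -2, …, -n)` of `B_n`. -/
def cycB (n : ℕ) : signedPerm n :=
  ⟨cyc (2 * n), by
    rw [signedPerm, Subgroup.mem_centralizer_singleton_iff]
    exact ((Commute.refl (finRotate (2 * n))).pow_right (2 * n / 2)).eq⟩

/-! ### Classical noncrossing partitions; partitions are equivalence relations, ordered by
refinement -/

section Classical

variable {X : Type*} [LinearOrder X]

/-- A partition of a linearly ordered set is noncrossing if there are no `a < b < c < d` with
`a, c` in one block and `b, d` in another block. -/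
def Noncrossing (P : Setoid X) : Prop :=
  ∀ a b c d : X, a < b → b < c → c < d → P a c → P b d → P a b

/-- The shuffle `⟨Q₁, …, Q_k⟩` of `k` partitions of `X`: the partition of `k` interleaved copies
`x₁ < ⋯ < x_k < y₁ < ⋯ < y_k < ⋯` of `X = {x < y < ⋯}` that is `Q_i` on the `i`-th copy. -/
def shuffle {k : ℕ} (Q : Fin k → Setoid X) : Setoid (X ×ₗ Fin k) where
  r p q := (ofLex p).2 = (ofLex q).2 ∧ Q (ofLex p).2 (ofLex p).1 (ofLex q).1
  iseqv :=
    { refl := fun _ => ⟨rfl, Setoid.refl' _ _⟩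
      symm := fun h => ⟨h.1.symm, h.1 ▸ Setoid.symm' _ h.2⟩
      trans := fun h h' => ⟨h.1.trans h'.1, Setoid.trans' _ h.2 (by rw [h.1]; exact h'.2)⟩ }

/-- The Kreweras complement `K(P)`: the coarsest partition `Q` such that the interleaving
`⟨P, Q⟩` is noncrossing. -/
noncomputable def kreweras (P : Setoid X) : Setoid X :=
  sSup {Q : Setoid X | Noncrossing (shuffle ![P, Q])}

/-- The relative Kreweras complement `K^R(P)`, for `P ≤ R`: the union over the blocks `U` of `R` of
the Kreweras complements in `U` of the restrictions `P|U`. -/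
noncomputable def relKreweras (R P : Setoid X) : Setoid X where
  r x y := ∃ U ∈ R.classes, ∃ (hx : x ∈ U) (hy : y ∈ U),
    kreweras (P.comap (Subtype.val : U → X)) ⟨x, hx⟩ ⟨y, hy⟩
  iseqv :=
    { refl := fun x => ⟨_, R.mem_classes x, R.refl' x, R.refl' x, Setoid.refl' _ _⟩
      symm := fun ⟨U, hU, hx, hy, h⟩ => ⟨U, hU, hy, hx, Setoid.symm' _ h⟩
      trans := by
        rintro x y z ⟨U, hU, hx, hy, h⟩ ⟨V, hV, hy', hz, h'⟩
        obtain rfl := Setoid.eq_of_mem_classes hU hy hV hy'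
        exact ⟨U, hU, hx, hz, Setoid.trans' _ h h'⟩ }

/-- The explicit form of the coarsest partition whose interleaving with `P` is noncrossing: `i` and
`j` are together iff the half-open interval between them is a union of blocks of `P`. -/
def krewerasAux (P : Setoid X) : Setoid X where
  r i j := ∀ a b, P a b → ((a ≤ i ↔ a ≤ j) ↔ (b ≤ i ↔ b ≤ j))
  iseqv :=
    { refl := fun _ _ _ _ => by tauto
      symm := fun h a b hab => by have := h a b hab; tauto
      trans := fun h h' a b hab => by have := h a b hab; have := h' a b hab; tauto }

theorem four_chain {p₁ p₂ p₃ p₄ q₁ q₂ q₃ q₄ : Prop} (hp₁ : p₁ → p₂) (hp₂ : p₂ → p₃)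
    (hp₃ : p₃ → p₄) (hq₁ : q₁ → q₂) (hq₂ : q₂ → q₃) (hq₃ : q₃ → q₄)
    (h : (p₁ ↔ p₃) ↔ (q₁ ↔ q₃)) (h' : (p₂ ↔ p₄) ↔ (q₂ ↔ q₄)) :
    (p₁ ↔ p₂) ↔ (q₁ ↔ q₂) := by
  by_cases p₁ <;> by_cases p₂ <;> by_cases p₃ <;> by_cases p₄ <;> simp_all <;>
  by_cases q₁ <;> by_cases q₂ <;> by_cases q₃ <;> simp_all

theorem two_chain {p q p' q' : Prop} (e : p → q) (e' : p' → q')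
    (h : ¬ p → q → ¬ p' ∧ q') (h' : ¬ p' → q' → ¬ p ∧ q) : (p ↔ q) ↔ (p' ↔ q') := by
  tauto

/-- For noncrossing `P` there is a coarsest `Q` such that `⟨P, Q⟩` is noncrossing. -/
theorem isGreatest_krewerasAux {P : Setoid X} (hP : Noncrossing P) :
    IsGreatest {Q : Setoid X | Noncrossing (shuffle ![P, Q])} (krewerasAux P) := by
  have hlt : ∀ p q : X ×ₗ Fin 2, p < q ↔
      (ofLex p).1 < (ofLex q).1 ∨ (ofLex p).1 = (ofLex q).1 ∧ (ofLex p).2 < (ofLex q).2 :=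
    fun _ _ => Prod.Lex.lt_iff
  constructor
  · intro p q r s hpq hqr hrs hpr hqs
    rw [hlt] at hpq hqr hrs
    obtain ⟨x, i⟩ := p
    obtain ⟨y, j⟩ := q
    obtain ⟨z, i'⟩ := r
    obtain ⟨w, j'⟩ := s
    obtain ⟨h1, hpr⟩ := hpr
    obtain ⟨h2, hqs⟩ := hqs
    simp only [ofLex] at *
    change i = i' at h1
    change j = j' at h2
    subst h1 h2
    change (![P, krewerasAux P] i) x z at hpr
    change (![P, krewerasAux P] j) y w at hqs
    change i = j ∧ (![P, krewerasAux P] i) x y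
    change x < y ∨ x = y ∧ i < j at hpq
    change y < z ∨ y = z ∧ j < i at hqr
    change z < w ∨ z = w ∧ i < j at hrs
    match i, j with
    | 0, 0 =>
      simp at hpq hqr hrs hpr hqs ⊢
      exact hP x y z w hpq hqr hrs hpr hqs
    | 1, 1 =>
      simp at hpq hqr hrs hpr hqs ⊢
      intro a b hab
      exact four_chain (fun h => h.trans hpq.le) (fun h => h.trans hqr.le)
        (fun h => h.trans hrs.le) (fun h => h.trans hpq.le) (fun h => h.trans hqr.le)
        (fun h => h.trans hrs.le) (hpr a b hab) (hqs a b hab)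
    | 0, 1 =>
      exfalso
      simp at hpq hqr hrs hpr hqs
      have h3 := hqs x z hpr
      have hrs : z ≤ w := le_iff_lt_or_eq.2 hrs
      have e1 : x ≤ y := le_iff_lt_or_eq.2 hpq
      have e2 : x ≤ w := (e1.trans hqr.le).trans hrs
      have e3 : ¬ z ≤ y := not_le.2 hqr
      have e4 : z ≤ w := hrs
      tauto
    | 1, 0 =>
      exfalso
      simp at hpq hqr hrs hpr hqs
      have h3 := hpr y w hqs
      have e1 : ¬ y ≤ x := not_le.2 hpq
      have hqr : y ≤ z := le_iff_lt_or_eq.2 hqr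
      have e2 : y ≤ z := hqr
      have e3 : ¬ w ≤ x := not_le.2 ((hpq.trans_le hqr).trans hrs)
      have e4 : ¬ w ≤ z := not_le.2 hrs
      tauto
  · intro Q hQ
    have key : ∀ i j a b, i < j → Q i j → P a b → a ≤ j → ¬ a ≤ i → b ≤ j ∧ ¬ b ≤ i := by
      intro i j a b hij hQij hab h1 h2
      rw [not_le] at h2
      by_contra hcon
      rcases le_or_gt b i with h3 | h3
      · have := hQ (toLex (b, 0)) (toLex (i, 1)) (toLex (a, 0)) (toLex (j, 1))
          ((hlt _ _).2 (by rcases h3.lt_or_eq with h | h <;> simp [h]))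
          ((hlt _ _).2 (by simp [h2]))
          ((hlt _ _).2 (by rcases h1.lt_or_eq with h | h <;> simp [h]))
          ⟨rfl, P.symm' hab⟩ ⟨rfl, hQij⟩
        exact absurd this.1 (by simp)
      · have h4 : j < b := by
          by_contra h4
          exact hcon ⟨not_lt.1 h4, not_le.2 h3⟩
        have := hQ (toLex (i, 1)) (toLex (a, 0)) (toLex (j, 1)) (toLex (b, 0))
          ((hlt _ _).2 (by simp [h2]))
          ((hlt _ _).2 (by rcases h1.lt_or_eq with h | h <;> simp [h]))
          ((hlt _ _).2 (by simp [h4]))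
          ⟨rfl, hQij⟩ ⟨rfl, hab⟩
        exact absurd this.1 (by simp)
    have key2 : ∀ i j, i < j → Q i j → krewerasAux P i j := by
      intro i j hij hQij a b hab
      have h1 := key i j a b hij hQij hab
      have h2 := key i j b a hij hQij (P.symm' hab)
      have e1 : a ≤ i → a ≤ j := fun h => h.trans hij.le
      have e2 : b ≤ i → b ≤ j := fun h => h.trans hij.le
      tauto
    intro i j hQij
    rcases lt_trichotomy i j with h | h | h
    · exact key2 i j h hQij
    · rw [h]
    · exact (krewerasAux P).symm' (key2 j i h (Q.symm' hQij))

theorem kreweras_eq {P : Setoid X} (hP : Noncrossing P) : kreweras P = krewerasAux P :=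
  (isGreatest_krewerasAux hP).isLUB.sSup_eq

theorem noncrossing_kreweras {P : Setoid X} (hP : Noncrossing P) : Noncrossing (kreweras P) := by
  rw [kreweras_eq hP]
  intro a b c d hab hbc hcd hac hbd x y hxy
  exact four_chain (fun h => h.trans hab.le) (fun h => h.trans hbc.le)
    (fun h => h.trans hcd.le) (fun h => h.trans hab.le) (fun h => h.trans hbc.le)
    (fun h => h.trans hcd.le) (hac x y hxy) (hbd x y hxy)

/-- A noncrossing partition can be recovered from its Kreweras complement. -/
theorem rel_iff_of_noncrossing [Finite X] {P : Setoid X} (hP : Noncrossing P) (i j : X) :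
    P i j ↔ ∀ u v, krewerasAux P u v → ((i ≤ u ↔ i ≤ v) ↔ (j ≤ u ↔ j ≤ v)) := by
  refine ⟨fun h u v huv => huv i j h, fun h => ?_⟩
  have key : ∀ i j, i < j →
      (∀ u v, krewerasAux P u v → ((i ≤ u ↔ i ≤ v) ↔ (j ≤ u ↔ j ≤ v))) → P i j := by
    clear h i j
    intro i j hij h
    by_contra hn
    -- the largest element of the block of `i` below `j`
    obtain ⟨m, ⟨him, hmj⟩, hm⟩ := Set.exists_max_image {x | P i x ∧ x < j} id (Set.toFinite _)
      ⟨i, P.refl' i, hij⟩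
    have hm : ∀ x, P i x → x < j → x ≤ m := fun x h1 h2 => hm x ⟨h1, h2⟩
    have himle : i ≤ m := hm i (P.refl' i) hij
    by_cases hex : ∃ x, P i x ∧ j < x
    · obtain ⟨m', ⟨him', hjm'⟩, hm'⟩ := Set.exists_min_image {x | P i x ∧ j < x} id
        (Set.toFinite _) hex
      have hm' : ∀ x, P i x → j < x → m' ≤ x := fun x h1 h2 => hm' x ⟨h1, h2⟩
      obtain ⟨v, hv, hvm⟩ := Set.exists_max_image {x | x < m'} id (Set.toFinite _) ⟨j, hjm'⟩
      have hvm : ∀ x, x < m' ↔ x ≤ v := fun x => ⟨fun hx => hvm x hx, fun hx => hx.trans_lt hv⟩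
      have hnb : ∀ x, m < x → x < m' → ¬ P i x := by
        intro x h1 h2 h3
        rcases lt_trichotomy x j with h4 | h4 | h4
        · exact absurd (hm x h3 h4) (not_le.2 h1)
        · exact hn (h4 ▸ h3)
        · exact absurd (hm' x h3 h4) (not_le.2 h2)
      have hcl : ∀ x y, P x y → m < x → x < m' → m < y ∧ y < m' := by
        intro x y hxy h1 h2
        have hx := hnb x h1 h2
        have hy : ¬ P i y := fun h3 => hx (P.trans' h3 (P.symm' hxy))
        by_contra hcon
        rcases lt_trichotomy y m with h3 | h3 | h3
        · have := hP y m x m' h3 h1 h2 (P.symm' hxy) (P.trans' (P.symm' him) him')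
          exact hy (P.trans' him (P.symm' this))
        · exact hy (h3 ▸ him)
        · rcases lt_trichotomy y m' with h4 | h4 | h4
          · exact hcon ⟨h3, h4⟩
          · exact hy (h4 ▸ him')
          · have := hP m x m' y h1 h2 h4 (P.trans' (P.symm' him) him') hxy
            exact hx (P.trans' him this)
      have hK : krewerasAux P m v := by
        intro a b hab
        have h1 := hcl a b hab
        have h2 := hcl b a (P.symm' hab)
        rw [hvm, hvm] at h1 h2
        rw [← not_le, ← not_le] at h1 h2
        have hmv : m ≤ v := (hvm m).1 (hmj.trans hjm')
        exact two_chain (fun h => h.trans hmv) (fun h => h.trans hmv) h1 h2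
      have h1 := h m v hK
      have e1 : i ≤ v := (hvm i).1 (hij.trans hjm')
      have e2 : j ≤ v := (hvm j).1 hjm'
      have e3 : ¬ j ≤ m := not_le.2 hmj
      simp [e1, e2, e3, himle] at h1
    · have hle : ∀ x, P i x → x ≤ m := by
        intro x hx
        rcases lt_trichotomy x j with h4 | h4 | h4
        · exact hm x hx h4
        · exact absurd (h4 ▸ hx) hn
        · exact absurd ⟨x, hx, h4⟩ hex
      obtain ⟨m₀, him₀, hm₀⟩ := Set.exists_min_image {x | P i x} id (Set.toFinite _)
        ⟨i, P.refl' i⟩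
      have hm₀ : ∀ x, P i x → m₀ ≤ x := fun x hx => hm₀ x hx
      have him₀ : P i m₀ := him₀
      have hcl : ∀ x y, P x y → m₀ ≤ x → x ≤ m → m₀ ≤ y ∧ y ≤ m := by
        intro x y hxy h1 h2
        by_cases hx : P i x
        · have hy := P.trans' hx hxy
          exact ⟨hm₀ y hy, hle y hy⟩
        have hy : ¬ P i y := fun h3 => hx (P.trans' h3 (P.symm' hxy))
        have h1 : m₀ < x := lt_of_le_of_ne h1 (fun h => hx (h ▸ him₀))
        have h2 : x < m := lt_of_le_of_ne h2 (fun h => hx (h ▸ him))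
        by_contra hcon
        rcases lt_or_ge y m₀ with h3 | h3
        · have := hP y m₀ x m h3 h1 h2 (P.symm' hxy) (P.trans' (P.symm' him₀) him)
          exact hy (P.trans' him₀ (P.symm' this))
        · have h4 : m < y := lt_of_not_ge fun h4 => hcon ⟨h3, h4⟩
          have := hP m₀ x m y h1 h2 h4 (P.trans' (P.symm' him₀) him) hxy
          exact hx (P.trans' him₀ this)
      have hm₀i : m₀ ≤ i := hm₀ i (P.refl' i)
      by_cases hbot : ∃ x, x < m₀
      · obtain ⟨u, hu, hum⟩ := Set.exists_max_image {x | x < m₀} id (Set.toFinite _) hbot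
        have hum : ∀ x, x < m₀ ↔ x ≤ u := fun x => ⟨fun hx => hum x hx, fun hx => hx.trans_lt hu⟩
        have hK : krewerasAux P u m := by
          intro a b hab
          have h1 := hcl a b hab
          have h2 := hcl b a (P.symm' hab)
          have hmu : u ≤ m := (hu.le.trans hm₀i).trans himle
          refine two_chain (fun h => h.trans hmu) (fun h => h.trans hmu)
            (fun g g' => ?_) (fun g g' => ?_)
          · rw [← hum, not_lt] at g ⊢
            exact h1 g g'
          · rw [← hum, not_lt] at g ⊢
            exact h2 g g'
        have h1 := h u m hK
        have e1 : ¬ i ≤ u := fun h => absurd ((hum i).2 h) (not_lt.2 hm₀i)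
        have e2 : ¬ j ≤ u := fun h => absurd ((hum j).2 h) (not_lt.2 (hm₀i.trans hij.le))
        have e3 : ¬ j ≤ m := not_le.2 hmj
        simp [e1, e2, e3, himle] at h1
      · obtain ⟨t, -, ht⟩ := Set.exists_max_image (Set.univ : Set X) id (Set.toFinite _)
          ⟨i, trivial⟩
        have ht : ∀ x, x ≤ t := fun x => ht x trivial
        have hK : krewerasAux P m t := by
          intro a b hab
          have h1 := hcl a b hab
          have h2 := hcl b a (P.symm' hab)
          have e1 : m₀ ≤ a := not_lt.1 fun h => hbot ⟨a, h⟩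
          have e2 : m₀ ≤ b := not_lt.1 fun h => hbot ⟨b, h⟩
          have f1 : a ≤ m ↔ b ≤ m := ⟨fun g => (h1 e1 g).2, fun g => (h2 e2 g).2⟩
          simp [ht, f1]
        have h1 := h m t hK
        have e3 : ¬ j ≤ m := not_le.2 hmj
        simp [ht, e3, himle] at h1
  rcases lt_trichotomy i j with h1 | h1 | h1
  · exact key i j h1 h
  · rw [h1]
  · exact P.symm' (key j i h1 fun u v huv => (h u v huv).symm)

theorem kreweras_injOn [Finite X] : Set.InjOn (kreweras (X := X)) {P | Noncrossing P} := by
  intro P hP Q hQ h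
  rw [kreweras_eq hP, kreweras_eq hQ] at h
  ext i j
  rw [rel_iff_of_noncrossing hP, rel_iff_of_noncrossing hQ, h]

/-- The Kreweras complement is a bijection of the set of noncrossing partitions onto itself. -/
theorem kreweras_bijOn [Finite X] :
    Set.BijOn (kreweras (X := X)) {P | Noncrossing P} {P | Noncrossing P} := by
  have hfin : Finite (Setoid X) :=
    Finite.of_injective (fun r : Setoid X => r.r) fun _ _ h => Setoid.ext fun a b => by
      have := congrFun (congrFun h a) b
      exact iff_of_eq this
  have hmaps : Set.MapsTo (kreweras (X := X)) {P | Noncrossing P} {P | Noncrossing P} :=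
    fun _ hP => noncrossing_kreweras hP
  exact ⟨hmaps, kreweras_injOn,
    ((Set.toFinite _).injOn_iff_bijOn_of_mapsTo hmaps).1 kreweras_injOn |>.surjOn⟩

/-- The inverse `K⁻¹` of the bijection `K` of the set of noncrossing partitions onto itself. -/
noncomputable def krewerasInv (Q : Setoid X) : Setoid X :=
  Function.invFunOn kreweras {P : Setoid X | Noncrossing P} Q

end Classical

/-- The shuffle of `k` partitions of `[m]` as a partition of `[mk]`: the `i`-th copy of `j ∈ [m]`
is `kj - (k - i) ∈ [mk]`. -/
def shuffleFin {m k : ℕ} (Q : Fin k → Setoid (Fin m)) : Setoid (Fin (m * k)) :=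
  (shuffle Q).comap fun x => toLex (x.divNat, x.modNat)

/-- The classical delta sequence
`∂(P)_k = (K^{P₂}(P₁), …, K^{P_k}(P_{k-1}), K(P_k))`. -/
noncomputable def classicalDelta {X : Type*} [LinearOrder X] {k : ℕ} (P : Fin k → Setoid X)
    (i : Fin k) : Setoid X :=
  if h : (i : ℕ) + 1 < k then relKreweras (P ⟨i + 1, h⟩) (P i) else kreweras (P i)

/-- The partition `{π}` of `[N]` into the orbits of the permutation `π`. -/
def orbitPartition {N : ℕ} (π : Equiv.Perm (Fin N)) : Setoid (Fin N) :=
  Equiv.Perm.SameCycle.setoid π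

/-- The shuffle `⟨∂({π})_k⟩` for a multichain `π` in `NC(A_{N-1})`. -/
noncomputable def shuffleDelta {N k : ℕ} (π : NCGroupDiv (reflA N) (cyc N) k) :
    Setoid (Fin (N * k)) :=
  shuffleFin (classicalDelta fun i => orbitPartition (π.1 i).1)

/-- The type `A` map `(π)_k ↦ K⁻¹⟨∂({π})_k⟩`. -/
noncomputable def nabla {N k : ℕ} (π : NCGroupDiv (reflA N) (cyc N) k) : Setoid (Fin (N * k)) :=
  krewerasInv (shuffleDelta π)

/-- Every block has cardinality divisible by `k`. -/
def Divisible {N : ℕ} (k : ℕ) (P : Setoid (Fin N)) : Prop := ∀ B ∈ P.classes, k ∣ B.ncard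

/-- Invariance under the antipodal map (half-turn). -/
def CentrallySymmetric {N : ℕ} (P : Setoid (Fin N)) : Prop :=
  ∀ x y, P (antipode N x) (antipode N y) ↔ P x y

/-- The centrally symmetric noncrossing partitions of `[±kn]` all of whose blocks have
cardinality divisible by `k`, ordered by refinement. -/
abbrev NCSymDiv (n k : ℕ) : Type :=
  {P : Setoid (Fin (2 * n * k)) // Noncrossing P ∧ CentrallySymmetric P ∧ Divisible k P}

end KDiv

open KDiv

/-! The proof is linear algebra on rational functions on the points. The reflection length of a
permutation is the codimension of the space of functions constant on its cycles
(`wordLength_reflA`); for a signed permutation it is the same codimension taken inside the odd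
functions (`wordLength_reflB_aux`).

On functions fixed by `u`, the operators `f ↦ f ∘ v - f` and `f ↦ f ∘ (u⁻¹ * v) - f` agree. If `u
≤_T v`, a dimension count shows that the first, restricted to these functions, already has the full
image of the second. Two points lie in one cycle of `u⁻¹ * v` iff the difference of their delta
functions is in that image, and its preimage under the first operator is the indicator of an
interval in a cycle of `v`. So the cycles of `u⁻¹ * v` form the relative Kreweras complement
(`BelowCyc.relKreweras_eq`). With `v = c`, this makes taking orbits an isomorphism from `[1, c]` to
the noncrossing partitions (`exists_belowCyc`, `BelowCyc.codim_add_iff`).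

For the type A map, let a delta sequence act on `k` interleaved copies of `[N]`, as a permutation
`d` of `[kN]`. The map sends the chain to the orbits of `w = c * d⁻¹`, with `c` the long cycle of
`[kN]`. A conjugate of `w` is a helix with as many cycles as `π₁`; hence `w` is below `c` iff the
lengths of `π₁` and of the deltas add up, which is the multichain condition (`isMultichain_iff`).
The order is handled by the order reversal of `K` and the additivity of length over the copies. As
`d` preserves residues mod `k`, `w` raises them by one, so its orbit sizes are multiples of `k`;
conversely, divisible block sizes force `w⁻¹ * c` to preserve residues (`exists_nablaPerm`).

For type B, total codimension is even plus odd codimension, both subadditive, so the type A order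
implies the type B order. The converse holds below `c`, where at most one cycle is its own antipode;
a parity argument closes the remaining gap of one (`NearlyPaired.split`). Finally, central symmetry
of the image means commuting with the half-turn, which for the whole chain is the same as commuting
entry by entry (`commute_nablaPerm_iff`). -/

namespace KDiv

open Module

/-! ### Fixed spaces of permutations and word lengths -/

section FixSub

variable {X Y : Type*}

/-- The space of rational functions that are constant on the cycles of `w`. -/
def fixSub (w : Equiv.Perm X) : Submodule ℚ (X → ℚ) where
  carrier := {f | ∀ x, f (w x) = f x}
  add_mem' hf hg x := by simp [hf x, hg x]
  zero_mem' _ := rfl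
  smul_mem' a f hf x := by simp [hf x]

theorem mem_fixSub {w : Equiv.Perm X} {f : X → ℚ} : f ∈ fixSub w ↔ ∀ x, f (w x) = f x := Iff.rfl

/-- The codimension in `V` of the functions in `V` that are fixed by `w`. -/
noncomputable def codim (V : Submodule ℚ (X → ℚ)) (w : Equiv.Perm X) : ℕ :=
  finrank ℚ V - finrank ℚ (fixSub w ⊓ V : Submodule ℚ (X → ℚ))

theorem codim_add [Finite X] (V : Submodule ℚ (X → ℚ)) (w : Equiv.Perm X) :
    codim V w + finrank ℚ (fixSub w ⊓ V : Submodule ℚ (X → ℚ)) = finrank ℚ V :=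
  Nat.sub_add_cancel (Submodule.finrank_mono inf_le_right)

theorem codim_top_add [Fintype X] (w : Equiv.Perm X) :
    codim ⊤ w + finrank ℚ (fixSub w) = Fintype.card X := by
  have := codim_add ⊤ w
  rwa [inf_top_eq, finrank_top, finrank_fintype_fun_eq_card] at this

theorem codim_one (V : Submodule ℚ (X → ℚ)) : codim V (1 : Equiv.Perm X) = 0 := by
  have h : fixSub (1 : Equiv.Perm X) = ⊤ := eq_top_iff.2 fun f _ x => rfl
  rw [codim, h, top_inf_eq, Nat.sub_self]

/-- Functions fixed by both factors are fixed by the product; apply the dimension formula for sum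
and intersection. -/
theorem codim_mul_le [Finite X] (V : Submodule ℚ (X → ℚ)) (u v : Equiv.Perm X) :
    codim V (u * v) ≤ codim V u + codim V v := by
  have h1 := Submodule.finrank_sup_add_finrank_inf_eq (fixSub u ⊓ V) (fixSub v ⊓ V)
  have h2 : finrank ℚ ((fixSub u ⊓ V) ⊔ (fixSub v ⊓ V) : Submodule ℚ (X → ℚ)) ≤ finrank ℚ V :=
    Submodule.finrank_mono (sup_le inf_le_right inf_le_right)
  have h3 : finrank ℚ ((fixSub u ⊓ V) ⊓ (fixSub v ⊓ V) : Submodule ℚ (X → ℚ)) ≤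
      finrank ℚ (fixSub (u * v) ⊓ V : Submodule ℚ (X → ℚ)) :=
    Submodule.finrank_mono fun f hf =>
      ⟨fun x => (hf.1.1 (v x)).trans (hf.2.1 x), hf.1.2⟩
  have := codim_add V u
  have := codim_add V v
  have := codim_add V (u * v)
  omega

theorem codim_le_one [Finite X] {V : Submodule ℚ (X → ℚ)} {t : Equiv.Perm X} (i j : X)
    (h : ∀ f ∈ V, f i = f j → f ∈ fixSub t) : codim V t ≤ 1 := by
  let φ : V →ₗ[ℚ] ℚ := ((LinearMap.proj i : (X → ℚ) →ₗ[ℚ] ℚ) - LinearMap.proj j).comp V.subtype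
  have h1 := φ.finrank_range_add_finrank_ker
  have h2 : finrank ℚ φ.range ≤ 1 := (Submodule.finrank_le _).trans (finrank_self ℚ).le
  have h3 : finrank ℚ φ.ker ≤ finrank ℚ (fixSub t ⊓ V : Submodule ℚ (X → ℚ)) := by
    rw [← Submodule.finrank_map_subtype_eq V φ.ker]
    refine Submodule.finrank_mono ?_
    rintro _ ⟨f, hf, rfl⟩
    exact ⟨h _ f.2 (sub_eq_zero.1 hf), f.2⟩
  have := codim_add V t
  omega

/-- The function `f` witnesses that the fixed space grows strictly; this is the descent step for
both word lengths. -/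
theorem codim_lt [Finite X] {V : Submodule ℚ (X → ℚ)} {u w : Equiv.Perm X}
    (h : fixSub w ⊓ V ≤ fixSub u) (f : X → ℚ) (hf : f ∈ V) (hu : f ∈ fixSub u)
    (hw : f ∉ fixSub w) : codim V u < codim V w := by
  have h1 : fixSub w ⊓ V < fixSub u ⊓ V :=
    lt_of_le_of_ne (le_inf h inf_le_right) fun he => hw (he.ge ⟨hu, hf⟩).1
  have := Submodule.finrank_lt_finrank_of_lt h1
  have := codim_add V u
  have := codim_add V w
  omega

theorem finrank_fixSub_permCongr (e : X ≃ Y) (w : Equiv.Perm X) :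
    finrank ℚ (fixSub (e.permCongr w)) = finrank ℚ (fixSub w) := by
  have : fixSub w = (fixSub (e.permCongr w)).map
      (LinearEquiv.funCongrLeft ℚ ℚ e : (Y → ℚ) →ₗ[ℚ] (X → ℚ)) := by
    ext f
    constructor
    · intro hf
      exact ⟨f ∘ e.symm, fun x => by simpa using hf (e.symm x), by ext x; simp⟩
    · rintro ⟨g, hg, rfl⟩ x
      simpa using hg (e x)
  rw [this, LinearEquiv.finrank_map_eq]

theorem codim_permCongr [Fintype X] [Fintype Y] (e : X ≃ Y) (w : Equiv.Perm X) :
    codim ⊤ (e.permCongr w) = codim ⊤ w := by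
  have := codim_top_add w
  have := codim_top_add (e.permCongr w)
  have := finrank_fixSub_permCongr e w
  have := Fintype.card_congr e
  omega

theorem codim_conj [Fintype X] (g w : Equiv.Perm X) : codim ⊤ (g * w * g⁻¹) = codim ⊤ w :=
  codim_permCongr g w

theorem eq_of_sameCycle {w : Equiv.Perm X} {f : X → ℚ} (hf : f ∈ fixSub w) {x y : X}
    (h : w.SameCycle x y) : f x = f y := by
  obtain ⟨i, rfl⟩ := h
  have hinv : ∀ x, f (w⁻¹ x) = f x := fun x => by
    have := hf (w⁻¹ x)
    simpa using this.symm
  induction i with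
  | zero => rfl
  | succ i ih => rw [add_comm, zpow_add, zpow_one, Equiv.Perm.mul_apply, hf, ih]
  | pred i ih =>
    rw [sub_eq_neg_add, zpow_add, zpow_neg_one, Equiv.Perm.mul_apply, hinv, ih]

open Classical in
theorem indicator_mem_fixSub (w : Equiv.Perm X) (x : X) :
    (fun z => if w.SameCycle x z then (1 : ℚ) else 0) ∈ fixSub w := fun z => by
  simp

theorem sameCycle_of_forall_fixSub {w : Equiv.Perm X} {x y : X}
    (h : ∀ f ∈ fixSub w, f x = f y) : w.SameCycle x y := by
  classical
  have := h _ (indicator_mem_fixSub w x)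
  by_contra hn
  simp [hn, Equiv.Perm.SameCycle.refl] at this

/-- Fixed functions separate cycles, by indicator functions, so the fixed space remembers exactly
the orbit partition, with order reversed. -/
theorem fixSub_le_iff {u v : Equiv.Perm X} :
    fixSub v ≤ fixSub u ↔ ∀ x y, u.SameCycle x y → v.SameCycle x y := by
  constructor
  · intro h x y hxy
    exact sameCycle_of_forall_fixSub fun f hf => eq_of_sameCycle (h hf) hxy
  · intro h f hf x
    exact (eq_of_sameCycle hf (h x (u x) (by simp [Equiv.Perm.SameCycle.refl]))).symm

end FixSub

/-! ### Word lengths from subadditive functions with descent -/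

section WordLength

variable {G : Type*} [Group G]

theorem exists_word {T : Set G} {r : G → ℕ} (h0 : ∀ w, r w = 0 → w = 1)
    (hdesc : ∀ w, w ≠ 1 → ∃ t ∈ T, t * t = 1 ∧ r (t * w) < r w) (m : ℕ) :
    ∀ w, r w ≤ m → ∃ l : List G, (∀ t ∈ l, t ∈ T) ∧ l.length ≤ m ∧ l.prod = w := by
  induction m with
  | zero => exact fun w hw => ⟨[], by simp, le_rfl, (h0 w (by omega)).symm⟩
  | succ m ih =>
    intro w hw
    by_cases h1 : w = 1
    · exact ⟨[], by simp, by simp, h1.symm⟩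
    obtain ⟨t, ht, htt, hlt⟩ := hdesc w h1
    obtain ⟨l, hl, hlen, hprod⟩ := ih (t * w) (by omega)
    refine ⟨t :: l, by simpa [ht] using hl, by simpa using hlen, ?_⟩
    rw [List.prod_cons, hprod, ← mul_assoc, htt, one_mul]

/-- A subadditive function that is at most `1` on the involutions in `T`, and can always be lowered
by one of them, is the word length. -/
theorem wordLength_eq {T : Set G} {r : G → ℕ} (h1 : r 1 = 0)
    (hmul : ∀ u v, r (u * v) ≤ r u + r v) (hT : ∀ t ∈ T, r t ≤ 1)
    (hdesc : ∀ w, w ≠ 1 → ∃ t ∈ T, t * t = 1 ∧ r (t * w) < r w) (w : G) :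
    wordLength T w = r w ∧ ∃ l : List G, (∀ t ∈ l, t ∈ T) ∧ l.length = r w ∧ l.prod = w := by
  have hlow : ∀ l : List G, (∀ t ∈ l, t ∈ T) → r l.prod ≤ l.length := by
    intro l
    induction l with
    | nil => simp [h1]
    | cons t l ih =>
      intro hl
      have := hT t (hl t (by simp))
      have := ih fun s hs => hl s (by simp [hs])
      have := hmul t l.prod
      simp only [List.prod_cons, List.length_cons]
      omega
  obtain ⟨l, hl, hlen, hprod⟩ := exists_word (T := T) (r := r) (fun w hw => by
    by_contra hne
    obtain ⟨t, -, -, hlt⟩ := hdesc w hne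
    omega) hdesc (r w) w le_rfl
  have hlen : l.length = r w := le_antisymm hlen (hprod ▸ hlow l hl)
  refine ⟨le_antisymm (Nat.sInf_le ⟨l, hl, hlen, hprod⟩) ?_, l, hl, hlen, hprod⟩
  refine le_csInf ⟨_, l, hl, hlen, hprod⟩ ?_
  rintro m ⟨l', hl', rfl, rfl⟩
  exact hlow l' hl'

end WordLength

/-! ### Reflection length in the symmetric group -/

section TypeA

variable {N : ℕ}

theorem mem_fixSub_swap {X : Type*} [DecidableEq X] {i j : X} {f : X → ℚ} (h : f i = f j) :
    f ∈ fixSub (Equiv.swap i j) := fun x => by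
  rw [Equiv.swap_apply_def]
  split_ifs with h1 h2
  · rw [h1, h]
  · rw [h2, h]
  · rfl

theorem codim_swap_le {X : Type*} [Finite X] [DecidableEq X] (i j : X) :
    codim ⊤ (Equiv.swap i j) ≤ 1 :=
  codim_le_one i j fun _ _ => mem_fixSub_swap

theorem single_mem_fixSub {X : Type*} [DecidableEq X] {w : Equiv.Perm X} {x : X}
    (hx : w x = x) : (Pi.single x 1 : X → ℚ) ∈ fixSub w := fun z => by
  have : w z = x ↔ z = x := by
    conv_lhs => rw [← hx]
    exact w.injective.eq_iff
  simp [Pi.single_apply, this]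

theorem wordLength_reflA_aux (w : Equiv.Perm (Fin N)) :
    wordLength (reflA N) w = codim ⊤ w ∧ ∃ l : List (Equiv.Perm (Fin N)),
      (∀ t ∈ l, t ∈ reflA N) ∧ l.length = codim ⊤ w ∧ l.prod = w := by
  refine wordLength_eq (codim_one ⊤) (codim_mul_le ⊤) ?_ ?_ w
  · rintro t ⟨i, j, -, rfl⟩
    exact codim_swap_le i j
  · intro w hw
    obtain ⟨x, hx⟩ : ∃ x, w x ≠ x := by
      by_contra h
      push Not at h
      exact hw (Equiv.ext h)
    -- This transposition splits `x` off its cycle: `x` becomes a fixed point, so its delta function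
    -- is newly fixed.
    refine ⟨Equiv.swap x (w x), ⟨x, w x, hx.symm, rfl⟩, Equiv.swap_mul_self _ _, ?_⟩
    refine codim_lt ?_ (Pi.single x 1) trivial (single_mem_fixSub (by simp)) ?_
    · rintro f ⟨hf, -⟩ z
      rw [Equiv.Perm.mul_apply, Equiv.swap_apply_def]
      split_ifs with h1 h2
      · rw [hf x, ← h1, hf]
      · rw [← hf z, h2, hf x]
      · exact hf z
    · intro h
      have := h x
      simp [hx] at this

theorem wordLength_reflA (w : Equiv.Perm (Fin N)) : wordLength (reflA N) w = codim ⊤ w :=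
  (wordLength_reflA_aux w).1

/-- The parity of the codimension is multiplicative data; it excludes a defect of one in
`NearlyPaired.split`. -/
theorem sign_eq_codim (w : Equiv.Perm (Fin N)) : Equiv.Perm.sign w = (-1) ^ codim ⊤ w := by
  obtain ⟨l, hl, hlen, rfl⟩ := (wordLength_reflA_aux w).2
  rw [Equiv.Perm.sign_prod_list_swap hl, hlen]

theorem absLE_reflA {u v : Equiv.Perm (Fin N)} :
    AbsLE (reflA N) u v ↔ codim ⊤ v = codim ⊤ u + codim ⊤ (u⁻¹ * v) := by
  simp only [AbsLE, wordLength_reflA]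

end TypeA

/-! ### The Kreweras complement of permutations, in terms of fixed functions -/

section Relative

variable {X : Type*}

/-- The map `f ↦ f ∘ w - f`, whose kernel is the space of functions fixed by `w`. -/
def diffMap (w : Equiv.Perm X) : (X → ℚ) →ₗ[ℚ] (X → ℚ) :=
  LinearMap.funLeft ℚ ℚ w - LinearMap.id

theorem diffMap_apply (w : Equiv.Perm X) (f : X → ℚ) (x : X) :
    diffMap w f x = f (w x) - f x := rfl

theorem ker_diffMap (w : Equiv.Perm X) : (diffMap w).ker = fixSub w := by
  ext f
  rw [LinearMap.mem_ker, mem_fixSub, funext_iff]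
  exact forall_congr' fun x => sub_eq_zero

theorem diffMap_eq_of_mem_fixSub {u v : Equiv.Perm X} {f : X → ℚ} (hf : f ∈ fixSub u) :
    diffMap (u⁻¹ * v) f = diffMap v f := by
  ext x
  have := hf (u⁻¹ (v x))
  rw [diffMap_apply, diffMap_apply, Equiv.Perm.mul_apply, ← this]
  simp

theorem finrank_range_diffMap [Fintype X] (w : Equiv.Perm X) :
    finrank ℚ (diffMap w).range = codim ⊤ w := by
  have h1 := (diffMap w).finrank_range_add_finrank_ker
  rw [ker_diffMap, finrank_fintype_fun_eq_card] at h1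
  have := codim_top_add w
  omega

/-- Rank-nullity for `diffMap v` restricted to `fixSub u`, whose kernel is all of `fixSub v`. -/
theorem finrank_map_diffMap_add [Finite X] {u v : Equiv.Perm X} (h : fixSub v ≤ fixSub u) :
    finrank ℚ ((fixSub u).map (diffMap v)) + finrank ℚ (fixSub v) = finrank ℚ (fixSub u) := by
  have h1 := ((diffMap v).domRestrict (fixSub u)).finrank_range_add_finrank_ker
  rw [LinearMap.range_domRestrict, LinearMap.ker_domRestrict, ker_diffMap] at h1
  rwa [← (Submodule.submoduleOfEquivOfLe h).finrank_eq]

theorem map_diffMap_le [Finite X] (u v : Equiv.Perm X) :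
    (fixSub u).map (diffMap v) ≤ (diffMap (u⁻¹ * v)).range := by
  rintro _ ⟨f, hf, rfl⟩
  exact ⟨f, diffMap_eq_of_mem_fixSub hf⟩

theorem diffMap_single [DecidableEq X] (w : Equiv.Perm X) (x : X) :
    diffMap w (Pi.single (w x) 1) = Pi.single x 1 - Pi.single (w x) 1 := by
  ext z
  simp [diffMap_apply, Pi.single_apply]

/-- The image of `diffMap w` is orthogonal to every fixed function `g`, since summing `g * (f ∘ w -
f)` over all points gives zero. -/
theorem sameCycle_of_mem_range [Fintype X] [DecidableEq X] {w : Equiv.Perm X} {x y : X}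
    {f : X → ℚ} (h : diffMap w f = Pi.single x 1 - Pi.single y 1) : w.SameCycle x y := by
  refine sameCycle_of_forall_fixSub fun g hg => ?_
  have h1 : ∑ z, g z * diffMap w f z = 0 := by
    simp only [diffMap_apply, mul_sub, Finset.sum_sub_distrib]
    rw [sub_eq_zero, ← Equiv.sum_comp w fun z => g z * f z]
    exact Finset.sum_congr rfl fun z _ => by rw [hg z]
  rw [h] at h1
  simpa [mul_sub, Finset.sum_sub_distrib, Pi.single_apply, sub_eq_zero] using h1

/-- Telescope along the cycle from `x` to `y`. -/
theorem single_sub_single_mem_range [Finite X] [DecidableEq X] {w : Equiv.Perm X} {x y : X}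
    (h : w.SameCycle x y) :
    (Pi.single x 1 - Pi.single y 1 : X → ℚ) ∈ (diffMap w).range := by
  obtain ⟨i, -, rfl⟩ := h.exists_pow_eq'
  induction i with
  | zero => simp
  | succ i ih =>
    have h2 : (Pi.single ((w ^ i) x) 1 - Pi.single ((w ^ (i + 1)) x) 1 : X → ℚ) ∈
        (diffMap w).range := ⟨_, by rw [pow_succ', Equiv.Perm.mul_apply]; exact diffMap_single _ _⟩
    have := add_mem (ih ⟨i, by simp⟩) h2
    rwa [sub_add_sub_cancel] at this

theorem range_diffMap_le [Finite X] [DecidableEq X] {w : Equiv.Perm X} {S : Submodule ℚ (X → ℚ)}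
    (h : ∀ x, (Pi.single x 1 - Pi.single (w x) 1 : X → ℚ) ∈ S) : (diffMap w).range ≤ S := by
  have := Fintype.ofFinite X
  rintro _ ⟨f, rfl⟩
  have hf : f = ∑ x, f (w x) • (Pi.single (w x) 1 : X → ℚ) := by
    rw [Equiv.sum_comp w fun x => f x • (Pi.single x 1 : X → ℚ)]
    ext z
    simp [Finset.sum_apply, Pi.single_apply]
  rw [hf, map_sum]
  refine sum_mem fun x _ => ?_
  rw [map_smul, diffMap_single]
  exact S.smul_mem _ (h x)

/-- Functions fixed by `u` and by `u⁻¹ * v` are fixed by `v`. Additivity of codimensions leaves no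
room for a strict inclusion, so the intersection is `fixSub v`. -/
theorem fixSub_le_of_codim_add [Fintype X] {u v : Equiv.Perm X}
    (h : codim ⊤ v = codim ⊤ u + codim ⊤ (u⁻¹ * v)) :
    fixSub v ≤ fixSub u ∧ fixSub v ≤ fixSub (u⁻¹ * v) := by
  have h1 := Submodule.finrank_sup_add_finrank_inf_eq (fixSub u) (fixSub (u⁻¹ * v))
  have h2 := Submodule.finrank_le (fixSub u ⊔ fixSub (u⁻¹ * v))
  rw [finrank_fintype_fun_eq_card] at h2
  have h3 : fixSub u ⊓ fixSub (u⁻¹ * v) ≤ fixSub v := fun f hf x => by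
    have h4 := hf.1 (u⁻¹ (v x))
    have h5 := hf.2 x
    rw [Equiv.Perm.mul_apply] at h5
    rw [← h5, ← h4]
    simp
  have := codim_top_add u
  have := codim_top_add v
  have := codim_top_add (u⁻¹ * v)
  have h6 := Submodule.eq_of_le_of_finrank_le h3 (by omega)
  exact ⟨h6.ge.trans inf_le_left, h6.ge.trans inf_le_right⟩

variable [LinearOrder X]

open Classical in
/-- The indicator function of the elements up to `y` of the cycle of `y`. -/
noncomputable def lower (v : Equiv.Perm X) (y z : X) : ℚ :=
  if v.SameCycle y z ∧ z ≤ y then 1 else 0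

/-- The permutation `v` sends every point to the next larger one of its cycle, if there is one, and
to the least one otherwise. -/
def CycInc (v : Equiv.Perm X) : Prop :=
  ∀ z, (z < v z ∧ ∀ y, v.SameCycle z y → y ≤ z ∨ v z ≤ y) ∨
    ∀ y, v.SameCycle z y → v z ≤ y ∧ y ≤ z

/-- The elements `x`, `y` are in one cycle `U` of `v`, and the half-open interval of `U` between them
is a union of cycles of `u`. -/
def RelKrew (v u : Equiv.Perm X) (x y : X) : Prop :=
  v.SameCycle x y ∧ lower v y - lower v x ∈ fixSub u

theorem diffMap_lower {v : Equiv.Perm X} (hv : CycInc v) {x y : X} (h : v.SameCycle x y) :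
    diffMap v (lower v y - lower v x) = Pi.single x 1 - Pi.single y 1 := by
  -- Along the cycle the indicator drops just after `y` and rises at the wraparound. The wraparound
  -- term does not depend on `y`, so it cancels in the difference.
  have key : ∀ y z, v.SameCycle y z → lower v y (v z) - lower v y z =
      (if v z ≤ z then 1 else 0) - (if z = y then 1 else 0) := by
    intro y z hyz
    have hyz' : v.SameCycle y (v z) := by simpa using hyz
    simp only [lower, hyz, hyz', true_and]
    rcases hv z with ⟨h1, h2⟩ | h1
    · have h3 := h2 y hyz.symm
      rw [if_neg (not_le.2 h1)]
      rcases h3 with h3 | h3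
      · rw [if_neg (not_le.2 (h3.trans_lt h1))]
        simp only [h3.ge_iff_eq']
      · have h4 : z < y := h1.trans_le h3
        rw [if_pos h3, if_pos h4.le, if_neg h4.ne]
        simp
    · have h2 := h1 y hyz.symm
      rw [if_pos h2.1, if_pos (h2.1.trans h2.2)]
      simp only [h2.2.ge_iff_eq']
  ext z
  simp only [diffMap_apply, Pi.sub_apply, Pi.single_apply]
  by_cases hz : v.SameCycle x z
  · have h1 := key x z hz
    have h2 := key y z (h.symm.trans hz)
    linarith
  · have hz' : ¬ v.SameCycle y z := fun h' => hz (h.trans h')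
    have hx : z ≠ x := fun h' => hz (h' ▸ .refl _ _)
    have hy : z ≠ y := fun h' => hz' (h' ▸ .refl _ _)
    simp [lower, hz, hz', hx, hy]

theorem sameCycle_of_relKrew [Fintype X] {u v : Equiv.Perm X} (hv : CycInc v) {x y : X}
    (h : RelKrew v u x y) : (u⁻¹ * v).SameCycle x y :=
  sameCycle_of_mem_range ((diffMap_eq_of_mem_fixSub h.2).trans (diffMap_lower hv h.1))

theorem relKrew_of_sameCycle [Fintype X] {u v : Equiv.Perm X} (hv : CycInc v)
    (h : codim ⊤ v = codim ⊤ u + codim ⊤ (u⁻¹ * v)) {x y : X}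
    (hxy : (u⁻¹ * v).SameCycle x y) : RelKrew v u x y := by
  obtain ⟨h1, h2⟩ := fixSub_le_of_codim_add h
  have hvxy := fixSub_le_iff.1 h2 x y hxy
  refine ⟨hvxy, ?_⟩
  have h3 := finrank_map_diffMap_add h1
  have h4 := finrank_range_diffMap (u⁻¹ * v)
  have := codim_top_add u
  have := codim_top_add v
  -- Additivity makes both dimensions equal to `codim ⊤ v - codim ⊤ u`, so `Pi.single x 1 -
  -- Pi.single y 1` has a preimage `f` fixed by `u`. It differs from the interval indicator by an
  -- element of `fixSub v`, which is also fixed by `u`.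
  have h5 := Submodule.eq_of_le_of_finrank_le (map_diffMap_le u v) (by omega)
  have h6 := single_sub_single_mem_range hxy
  rw [← h5] at h6
  obtain ⟨f, hf, hfe⟩ := h6
  rw [← diffMap_lower hv hvxy] at hfe
  have h7 : lower v y - lower v x - f ∈ fixSub v := by
    rw [← ker_diffMap, LinearMap.mem_ker, map_sub, hfe, sub_self]
  simpa using add_mem (h1 h7) hf

/-- The steps of `u⁻¹ * v` span the image of its difference map. If each is the image of a `u`-fixed
interval indicator, then that image is at most as large as additivity requires; subadditivity is the
other bound. -/
theorem codim_add_of_relKrew [Fintype X] {u v : Equiv.Perm X} (hv : CycInc v)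
    (h : fixSub v ≤ fixSub u) (hs : ∀ x, RelKrew v u x ((u⁻¹ * v) x)) :
    codim ⊤ v = codim ⊤ u + codim ⊤ (u⁻¹ * v) := by
  have h1 : (diffMap (u⁻¹ * v)).range ≤ (fixSub u).map (diffMap v) :=
    range_diffMap_le fun x => ⟨_, (hs x).2, diffMap_lower hv (hs x).1⟩
  have h2 := Submodule.finrank_mono h1
  have h3 := finrank_map_diffMap_add h
  rw [finrank_range_diffMap] at h2
  have := codim_top_add u
  have := codim_top_add v
  have := codim_mul_le ⊤ u (u⁻¹ * v)
  rw [mul_inv_cancel_left] at this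
  omega

/-- The hypothesis makes both differences have the same sign, so they agree as soon as they vanish
together. -/
theorem ite_sub_ite_eq_iff {p q p' q' : Prop} [Decidable p] [Decidable q] [Decidable p']
    [Decidable q'] (h : (p → q) ∧ (p' → q') ∨ (q → p) ∧ (q' → p')) :
    ((if q then 1 else 0) - (if p then 1 else 0) : ℚ) =
      (if q' then 1 else 0) - (if p' then 1 else 0) ↔ ((p ↔ q) ↔ (p' ↔ q')) := by
  by_cases hp : p <;> by_cases hq : q <;> by_cases hp' : p' <;> by_cases hq' : q' <;>
    simp only [hp, hq, hp', hq', if_true, if_false] at h ⊢ <;> revert h <;> norm_num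

theorem relKrew_iff {u v : Equiv.Perm X} (h : fixSub v ≤ fixSub u) {x y : X} :
    RelKrew v u x y ↔ v.SameCycle x y ∧ ∀ a b, v.SameCycle x a → u.SameCycle a b →
      ((a ≤ x ↔ a ≤ y) ↔ (b ≤ x ↔ b ≤ y)) := by
  classical
  refine and_congr_right fun hxy => ?_
  have key : ∀ a b, v.SameCycle x a → v.SameCycle x b →
      ((lower v y - lower v x) a = (lower v y - lower v x) b ↔
        ((a ≤ x ↔ a ≤ y) ↔ (b ≤ x ↔ b ≤ y))) := fun a b ha hb => by
    simp only [lower, Pi.sub_apply, ha, hb, hxy.symm.trans ha, hxy.symm.trans hb, true_and]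
    convert ite_sub_ite_eq_iff ?_ using 3
    rcases le_total x y with h2 | h2
    · exact .inl ⟨fun h => h.trans h2, fun h => h.trans h2⟩
    · exact .inr ⟨fun h => h.trans h2, fun h => h.trans h2⟩
  constructor
  · intro hf a b ha hab
    exact (key a b ha (ha.trans (fixSub_le_iff.1 h a b hab))).1 (eq_of_sameCycle hf hab)
  · intro hK z
    have hz : u.SameCycle z (u z) := by simp [Equiv.Perm.SameCycle.refl]
    have hvz := fixSub_le_iff.1 h z (u z) hz
    by_cases hxz : v.SameCycle x z
    · exact ((key _ _ hxz (hxz.trans hvz)).2 (hK z (u z) hxz hz)).symm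
    · have h1 : ¬ v.SameCycle x (u z) := fun h' => hxz (h'.trans hvz.symm)
      have h2 : ¬ v.SameCycle y z := fun h' => hxz (hxy.trans h')
      have h3 : ¬ v.SameCycle y (u z) := fun h' => h1 (hxy.trans h')
      simp [lower, *]

end Relative

/-! ### Noncrossing partitions and the interval below the long cycle -/

section NoncrossingPerm

variable {N : ℕ}

theorem cyc_val (x : Fin N) : (cyc N x : ℕ) = (x + 1) % N := by
  cases N with
  | zero => exact x.elim0
  | succ n =>
    rw [cyc, finRotate_apply, Fin.val_add]
    simp

theorem cyc_pow_val (m : ℕ) (x : Fin N) : ((cyc N ^ m) x : ℕ) = (x + m) % N := by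
  induction m with
  | zero => simp [Nat.mod_eq_of_lt x.2]
  | succ m ih => rw [pow_succ', Equiv.Perm.mul_apply, cyc_val, ih, Nat.mod_add_mod, add_assoc]

theorem sameCycle_cyc (x y : Fin N) : (cyc N).SameCycle x y := by
  refine ⟨((N - x + y : ℕ) : ℤ), Fin.ext ?_⟩
  rw [zpow_natCast, cyc_pow_val, ← add_assoc, Nat.add_sub_cancel' x.2.le, Nat.add_mod_left,
    Nat.mod_eq_of_lt y.2]

theorem cyc_cases (z : Fin N) :
    ((cyc N z : ℕ) = z + 1) ∨ ((cyc N z : ℕ) = 0 ∧ (z : ℕ) + 1 = N) := by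
  rcases Nat.lt_or_ge (z + 1) N with h | h
  · exact .inl (by rw [cyc_val, Nat.mod_eq_of_lt h])
  · have h1 : (z : ℕ) + 1 = N := le_antisymm z.2 h
    exact .inr ⟨by rw [cyc_val, h1, Nat.mod_self], h1⟩

theorem cycInc_cyc : CycInc (cyc N) := by
  intro z
  rcases cyc_cases z with h | ⟨h, h'⟩
  · refine .inl ⟨Fin.lt_def.2 (by omega), fun y _ => ?_⟩
    rw [Fin.le_def, Fin.le_def]
    omega
  · refine .inr fun y _ => ?_
    rw [Fin.le_def, Fin.le_def]
    omega

theorem fixSub_cyc_le (u : Equiv.Perm (Fin N)) : fixSub (cyc N) ≤ fixSub u :=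
  fixSub_le_iff.2 fun x y _ => sameCycle_cyc x y

theorem codim_cyc_add_one (hN : 0 < N) : codim ⊤ (cyc N) + 1 = N := by
  have h1 := codim_top_add (cyc N)
  have h2 : fixSub (cyc N) = Submodule.span ℚ {(1 : Fin N → ℚ)} := by
    ext f
    rw [Submodule.mem_span_singleton]
    constructor
    · intro hf
      exact ⟨f ⟨0, hN⟩, funext fun x => by
        simpa using eq_of_sameCycle hf (sameCycle_cyc ⟨0, hN⟩ x)⟩
    · rintro ⟨a, rfl⟩ x
      simp
  have h3 : (1 : Fin N → ℚ) ≠ 0 := fun h => one_ne_zero (congrFun h ⟨0, hN⟩)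
  rwa [h2, finrank_span_singleton h3, Fintype.card_fin] at h1

theorem orbitPartition_le_iff {u v : Equiv.Perm (Fin N)} :
    orbitPartition u ≤ orbitPartition v ↔ fixSub v ≤ fixSub u :=
  fixSub_le_iff.symm

theorem relKrew_cyc_iff {u : Equiv.Perm (Fin N)} {x y : Fin N} :
    RelKrew (cyc N) u x y ↔ krewerasAux (orbitPartition u) x y := by
  rw [relKrew_iff (fixSub_cyc_le u)]
  exact ⟨fun h a b => h.2 a b (sameCycle_cyc x a), fun h => ⟨sameCycle_cyc x y, fun a b _ => h a b⟩⟩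

/-- The permutations below the long cycle in the absolute order. -/
def BelowCyc (u : Equiv.Perm (Fin N)) : Prop :=
  codim ⊤ (cyc N) = codim ⊤ u + codim ⊤ (u⁻¹ * cyc N)

theorem belowCyc_iff_absLE {u : Equiv.Perm (Fin N)} : BelowCyc u ↔ AbsLE (reflA N) u (cyc N) :=
  absLE_reflA.symm

theorem absLE_one_left (u : Equiv.Perm (Fin N)) : AbsLE (reflA N) 1 u := by
  rw [absLE_reflA, codim_one, inv_one, one_mul, zero_add]

theorem belowCyc_iff {u : Equiv.Perm (Fin N)} :
    BelowCyc u ↔ ∀ x, krewerasAux (orbitPartition u) x ((u⁻¹ * cyc N) x) := by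
  simp only [← relKrew_cyc_iff]
  refine ⟨fun h x => relKrew_of_sameCycle cycInc_cyc h ?_,
    codim_add_of_relKrew cycInc_cyc (fixSub_cyc_le u)⟩
  simp only [Equiv.Perm.sameCycle_apply_right, Equiv.Perm.SameCycle.refl]

theorem BelowCyc.krewerasAux_eq {u : Equiv.Perm (Fin N)} (h : BelowCyc u) :
    krewerasAux (orbitPartition u) = orbitPartition (u⁻¹ * cyc N) := by
  ext x y
  rw [← relKrew_cyc_iff]
  exact ⟨sameCycle_of_relKrew cycInc_cyc, relKrew_of_sameCycle cycInc_cyc h⟩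

/-- The complement of `u⁻¹ * c` is `c⁻¹ * u * c`, of the same length as `u`. -/
theorem BelowCyc.inv_mul_cyc {u : Equiv.Perm (Fin N)} (h : BelowCyc u) :
    BelowCyc (u⁻¹ * cyc N) := by
  have h1 : (u⁻¹ * cyc N)⁻¹ * cyc N = (cyc N)⁻¹ * u * (cyc N)⁻¹⁻¹ := by group
  rw [BelowCyc, h1, codim_conj, add_comm]
  exact h

theorem BelowCyc.cyc_mul_inv {u : Equiv.Perm (Fin N)} (h : BelowCyc u) :
    BelowCyc (cyc N * u⁻¹) := by
  have h1 : (cyc N * u⁻¹)⁻¹ * cyc N = u := by group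
  have h2 : cyc N * u⁻¹ = cyc N * (u⁻¹ * cyc N) * (cyc N)⁻¹ := by group
  rw [BelowCyc, h1, h2, codim_conj, add_comm]
  exact h

/-- Here `P` may be crossing, so this can serve to prove that orbit partitions are noncrossing in
the first place. -/
theorem noncrossing_krewerasAux {X : Type*} [LinearOrder X] (P : Setoid X) :
    Noncrossing (krewerasAux P) := by
  intro a b c d hab hbc hcd hac hbd x y hxy
  exact four_chain (fun h => h.trans hab.le) (fun h => h.trans hbc.le)
    (fun h => h.trans hcd.le) (fun h => h.trans hab.le) (fun h => h.trans hbc.le)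
    (fun h => h.trans hcd.le) (hac x y hxy) (hbd x y hxy)

/-- The orbits of `u` are the Kreweras complement of those of `c * u⁻¹`. -/
theorem BelowCyc.noncrossing {u : Equiv.Perm (Fin N)} (h : BelowCyc u) :
    Noncrossing (orbitPartition u) := by
  have h1 := h.cyc_mul_inv.krewerasAux_eq
  have h2 : (cyc N * u⁻¹)⁻¹ * cyc N = u := by group
  rw [h2] at h1
  rw [← h1]
  exact noncrossing_krewerasAux _

theorem krewerasAux_anti {X : Type*} [LinearOrder X] {P Q : Setoid X} (h : P ≤ Q) :
    krewerasAux Q ≤ krewerasAux P :=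
  fun _ _ hK a b hab => hK a b (h hab)

theorem krewerasAux_le_iff {X : Type*} [LinearOrder X] [Finite X] {P Q : Setoid X}
    (hP : Noncrossing P) (hQ : Noncrossing Q) : krewerasAux Q ≤ krewerasAux P ↔ P ≤ Q := by
  refine ⟨fun h i j hij => ?_, krewerasAux_anti⟩
  rw [rel_iff_of_noncrossing hP] at hij
  exact (rel_iff_of_noncrossing hQ i j).2 fun u v huv => hij u v (h huv)

theorem BelowCyc.krewerasAux_step {u : Equiv.Perm (Fin N)} (h : BelowCyc u) (j : Fin N) :
    ∃ i, cyc N i = u j ∧ krewerasAux (orbitPartition u) i j := by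
  refine ⟨(cyc N)⁻¹ (u j), by simp, ?_⟩
  have := belowCyc_iff.1 h ((cyc N)⁻¹ (u j))
  simpa using this

/-- If `i < i'`, the interval `(i, i']` is a union of blocks that contains the successor of `i` but
not that of `i'`, even when the latter wraps to the least point. -/
theorem eq_of_cyc_rel {P : Setoid (Fin N)} {i i' : Fin N} (h : krewerasAux P i i')
    (h' : P (cyc N i) (cyc N i')) : i = i' := by
  wlog hlt : i < i' generalizing i i'
  · rcases lt_trichotomy i i' with h1 | h1 | h1
    · exact absurd h1 hlt
    · exact h1
    · exact (this (Setoid.symm' _ h) (P.symm' h') h1).symm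
  have h1 := h _ _ h'
  simp only [Fin.le_def] at h1
  rw [Fin.lt_def] at hlt
  rcases cyc_cases i with h2 | h2 <;> rcases cyc_cases i' with h3 | h3 <;> omega

/-- The image `u j` is the successor of a point Kreweras-related to `j`, and only one such successor
lies in the block of `j`. -/
theorem BelowCyc.eq_of_orbitPartition_eq {u v : Equiv.Perm (Fin N)} (hu : BelowCyc u)
    (hv : BelowCyc v) (h : orbitPartition u = orbitPartition v) : u = v := by
  ext1 j
  obtain ⟨i, hi, hij⟩ := hu.krewerasAux_step j
  obtain ⟨i', hi', hij'⟩ := hv.krewerasAux_step j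
  rw [← hi, ← hi']
  rw [← h] at hij'
  congr 1
  refine eq_of_cyc_rel (Setoid.trans' _ hij (Setoid.symm' _ hij')) ?_
  rw [hi, hi']
  have h1 : orbitPartition u j (u j) := by
    change u.SameCycle _ _
    simp [Equiv.Perm.SameCycle.refl]
  have h2 : orbitPartition v j (v j) := by
    change v.SameCycle _ _
    simp [Equiv.Perm.SameCycle.refl]
  rw [← h] at h2
  exact Setoid.trans' _ (Setoid.symm' _ h1) h2

theorem BelowCyc.cycInc {u : Equiv.Perm (Fin N)} (hu : BelowCyc u) : CycInc u := by
  intro j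
  obtain ⟨i, hi, hij⟩ := hu.krewerasAux_step j
  have h1 : u.SameCycle j (u j) := by simp [Equiv.Perm.SameCycle.refl]
  rw [← hi] at h1 ⊢
  have h2 := hij _ _ h1
  simp only [Fin.le_def, Fin.lt_def] at h2 ⊢
  rcases cyc_cases i with h3 | h3
  · rcases Nat.lt_or_ge j (cyc N i) with h4 | h4
    · refine .inl ⟨h4, fun y hy => ?_⟩
      have := hij j y hy
      simp only [Fin.le_def] at this
      omega
    · refine .inr fun y hy => ?_
      have := hij j y hy
      simp only [Fin.le_def] at this
      omega
  · refine .inr fun y hy => ?_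
    have := hij j y hy
    simp only [Fin.le_def] at this
    omega

/-- In a noncrossing partition, the interval between two cyclically consecutive elements of a block
is a union of blocks. -/
theorem exists_krewerasAux_step {P : Setoid (Fin N)} (hP : Noncrossing P) (j : Fin N) :
    ∃ i, P j (cyc N i) ∧ krewerasAux P i j := by
  by_cases hex : ∃ x, P j x ∧ j < x
  · obtain ⟨m, ⟨hjm, hlt⟩, hmin⟩ := Set.exists_min_image {x | P j x ∧ j < x} id (Set.toFinite _) hex
    have hmin : ∀ x, P j x → j < x → m ≤ x := fun x h1 h2 => hmin x ⟨h1, h2⟩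
    have hcl : ∀ x y, P x y → j < x → x < m → j < y ∧ y < m := by
      intro x y hxy h1 h2
      have hx : ¬ P j x := fun h => absurd (hmin x h h1) (not_le.2 h2)
      have hy : ¬ P j y := fun h => hx (P.trans' h (P.symm' hxy))
      by_contra hcon
      rcases lt_trichotomy y j with h3 | h3 | h3
      · exact hy (P.symm' (hP y j x m h3 h1 h2 (P.symm' hxy) hjm))
      · exact hy (h3 ▸ P.refl' j)
      · have h4 : m ≤ y := not_lt.1 fun h4 => hcon ⟨h3, h4⟩
        rcases h4.lt_or_eq with h4 | h4
        · exact hx (hP j x m y h1 h2 h4 hjm hxy)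
        · exact hy (h4 ▸ hjm)
    rw [Fin.lt_def] at hlt
    have hi : (m : ℕ) - 1 < N := by omega
    have hc : cyc N ⟨m - 1, hi⟩ = m := by
      have := cyc_cases (⟨m - 1, hi⟩ : Fin N)
      apply Fin.ext
      simp only at this
      omega
    refine ⟨⟨m - 1, hi⟩, by rwa [hc], fun a b hab => ?_⟩
    have h1 := hcl a b hab
    have h2 := hcl b a (P.symm' hab)
    simp only [Fin.le_def, Fin.lt_def] at h1 h2 ⊢
    omega
  · obtain ⟨m, hjm, hmin⟩ := Set.exists_min_image {x | P j x} id (Set.toFinite _) ⟨j, P.refl' j⟩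
    have hjm : P j m := hjm
    have hmin : ∀ x, P j x → m ≤ x := fun x h1 => hmin x h1
    have hmax : ∀ x, P j x → x ≤ j := fun x h1 => not_lt.1 fun h2 => hex ⟨x, h1, h2⟩
    have hcl : ∀ x y, P x y → m ≤ x → x ≤ j → m ≤ y ∧ y ≤ j := by
      intro x y hxy h1 h2
      by_cases hx : P j x
      · have hy := P.trans' hx hxy
        exact ⟨hmin y hy, hmax y hy⟩
      have hy : ¬ P j y := fun h => hx (P.trans' h (P.symm' hxy))
      have h1 : m < x := lt_of_le_of_ne h1 fun h => hx (h ▸ hjm)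
      have h2 : x < j := lt_of_le_of_ne h2 fun h => hx (h ▸ P.refl' j)
      by_contra hcon
      rcases lt_or_ge y m with h3 | h3
      · exact hy (P.trans' hjm (P.symm' (hP y m x j h3 h1 h2 (P.symm' hxy) (P.symm' hjm))))
      · have h4 : j < y := lt_of_not_ge fun h4 => hcon ⟨h3, h4⟩
        exact hx (P.trans' hjm (hP m x j y h1 h2 h4 (P.symm' hjm) hxy))
    have hle := hmin j (P.refl' j)
    refine ⟨(cyc N)⁻¹ m, by simpa using hjm, fun a b hab => ?_⟩
    have h0 := cyc_cases ((cyc N)⁻¹ m)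
    have h1 := hcl a b hab
    have h2 := hcl b a (P.symm' hab)
    rw [Equiv.Perm.coe_inv, Equiv.apply_symm_apply] at h0
    simp only [Fin.le_def, Equiv.Perm.coe_inv] at h0 h1 h2 hle ⊢
    omega

theorem exists_belowCyc {P : Setoid (Fin N)} (hP : Noncrossing P) :
    ∃ u : Equiv.Perm (Fin N), BelowCyc u ∧ orbitPartition u = P := by
  choose p h1 h2 using exists_krewerasAux_step hP
  -- If `p j = p j'`, then `j` and `j'` are in one block of `P` and also Kreweras-related. Testing
  -- the relation on the pair itself forces `j = j'`.
  have hinj : Function.Injective fun j => cyc N (p j) := fun j j' h => by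
    have h : p j = p j' := (cyc N).injective h
    have h3 : krewerasAux P j j' := Setoid.trans' _ (Setoid.symm' _ (h2 j)) (h ▸ h2 j')
    have h4 := h3 j j' (P.trans' (h1 j) (h ▸ P.symm' (h1 j')))
    simp only [le_refl, true_iff, iff_true] at h4
    exact (le_total j j').elim (fun h => h.antisymm (h4.1 h)) fun h => (h4.2 h).antisymm h
  let u : Equiv.Perm (Fin N) := Equiv.ofBijective _ (Finite.injective_iff_bijective.1 hinj)
  have hu : ∀ j, u j = cyc N (p j) := fun j => rfl
  have hle : orbitPartition u ≤ P := by
    rintro x _ ⟨i, rfl⟩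
    induction i with
    | zero => exact P.refl' x
    | succ i ih =>
      rw [add_comm, zpow_add, zpow_one, Equiv.Perm.mul_apply, hu]
      exact P.trans' ih (h1 _)
    | pred i ih =>
      have h3 := h1 ((u ^ (-(i : ℤ) - 1)) x)
      rw [← hu, ← Equiv.Perm.mul_apply, ← zpow_one_add, add_sub_cancel] at h3
      exact P.trans' ih (P.symm' h3)
  have hK : ∀ x, krewerasAux P x ((u⁻¹ * cyc N) x) := fun x => by
    have h3 := h2 ((u⁻¹ * cyc N) x)
    have h4 : u ((u⁻¹ * cyc N) x) = cyc N x := by simp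
    rw [hu] at h4
    rwa [(cyc N).injective h4] at h3
  have hbelow : BelowCyc u := belowCyc_iff.2 fun x => krewerasAux_anti hle (hK x)
  refine ⟨u, hbelow, le_antisymm hle ?_⟩
  -- Comparing complements turns the reverse inclusion into the statement that steps of `u⁻¹ * c`
  -- stay inside classes of `krewerasAux P`.
  rw [← krewerasAux_le_iff hP hbelow.noncrossing, hbelow.krewerasAux_eq]
  change ∀ ⦃x y⦄, (u⁻¹ * cyc N).SameCycle x y → krewerasAux P x y
  rintro x _ hxy
  obtain ⟨i, -, rfl⟩ := hxy.exists_pow_eq'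
  clear hxy
  induction i with
  | zero => exact Setoid.refl' _ x
  | succ i ih =>
    rw [pow_succ', Equiv.Perm.mul_apply]
    exact Setoid.trans' _ ih (hK _)

theorem BelowCyc.codim_add_iff {u v : Equiv.Perm (Fin N)} (hu : BelowCyc u) (hv : BelowCyc v) :
    codim ⊤ v = codim ⊤ u + codim ⊤ (u⁻¹ * v) ↔ orbitPartition u ≤ orbitPartition v := by
  refine ⟨fun h => orbitPartition_le_iff.2 (fixSub_le_of_codim_add h).1, fun hle => ?_⟩
  rw [orbitPartition_le_iff] at hle
  refine codim_add_of_relKrew hv.cycInc hle fun x => (relKrew_iff hle).2 ?_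
  have hux : u.SameCycle ((u⁻¹ * v) x) (v x) := by
    rw [← Equiv.Perm.sameCycle_apply_left]
    simp [Equiv.Perm.SameCycle.refl]
  have hvx : v.SameCycle x (v x) := by simp [Equiv.Perm.SameCycle.refl]
  refine ⟨hvx.trans (fixSub_le_iff.1 hle _ _ hux).symm, fun a b ha hab => ?_⟩
  -- Here `i` is the cyclic predecessor of `v x`. No point of the `v`-cycle of `x` lies strictly
  -- between `x` and `v x`, so `i` and `x` cut that cycle in the same way, up to wraparound.
  obtain ⟨i, hi, hiK⟩ := hu.krewerasAux_step ((u⁻¹ * v) x)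
  have h1 := hiK a b hab
  have hb := ha.trans (fixSub_le_iff.1 hle _ _ hab)
  have h2 : cyc N i = v x := by rw [hi]; simp
  have h3 := cyc_cases i
  have hva := hv.cycInc x
  rw [h2] at h3
  simp only [Fin.le_def, Fin.lt_def] at h1 hva ⊢
  rcases hva with ⟨h4, h5⟩ | h5
  · have := h5 a ha
    have := h5 b hb
    omega
  · have := h5 a ha
    have := h5 b hb
    omega

theorem BelowCyc.of_codim_add {u v : Equiv.Perm (Fin N)} (hv : BelowCyc v)
    (h : codim ⊤ v = codim ⊤ u + codim ⊤ (u⁻¹ * v)) : BelowCyc u := by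
  rw [BelowCyc] at *
  have h1 := codim_mul_le ⊤ u (u⁻¹ * cyc N)
  have h2 := codim_mul_le ⊤ (u⁻¹ * v) (v⁻¹ * cyc N)
  rw [mul_inv_cancel_left] at h1
  rw [mul_assoc, mul_inv_cancel_left] at h2
  omega

theorem BelowCyc.kreweras_eq {u : Equiv.Perm (Fin N)} (h : BelowCyc u) :
    kreweras (orbitPartition u) = orbitPartition (u⁻¹ * cyc N) := by
  rw [KDiv.kreweras_eq h.noncrossing, h.krewerasAux_eq]

theorem BelowCyc.relKreweras_eq {u v : Equiv.Perm (Fin N)} (hv : BelowCyc v)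
    (h : codim ⊤ v = codim ⊤ u + codim ⊤ (u⁻¹ * v)) :
    relKreweras (orbitPartition v) (orbitPartition u) = orbitPartition (u⁻¹ * v) := by
  have hu := hv.of_codim_add h
  have hle := (fixSub_le_of_codim_add h).1
  have hnc : ∀ U : Set (Fin N),
      Noncrossing ((orbitPartition u).comap (Subtype.val : U → Fin N)) :=
    fun U a b c d h1 h2 h3 => hu.noncrossing a.1 b.1 c.1 d.1 h1 h2 h3
  ext x y
  have key : RelKrew v u x y ↔ (u⁻¹ * v).SameCycle x y :=
    ⟨sameCycle_of_relKrew hv.cycInc, relKrew_of_sameCycle hv.cycInc h⟩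
  change _ ↔ (u⁻¹ * v).SameCycle x y
  rw [← key, relKrew_iff hle]
  constructor
  · rintro ⟨U, ⟨w, rfl⟩, hx, hy, hK⟩
    have hx : v.SameCycle x w := hx
    have hy : v.SameCycle y w := hy
    rw [KDiv.kreweras_eq (hnc _)] at hK
    refine ⟨hx.trans hy.symm, fun a b ha hab => ?_⟩
    have ha' : v.SameCycle a w := ha.symm.trans hx
    exact hK ⟨a, ha'⟩ ⟨b, (fixSub_le_iff.1 hle _ _ hab).symm.trans ha'⟩ hab
  · rintro ⟨hxy, hK⟩
    refine ⟨_, ⟨x, rfl⟩, Equiv.Perm.SameCycle.refl v x, hxy.symm, ?_⟩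
    rw [KDiv.kreweras_eq (hnc _)]
    exact fun a b hab => hK a.1 b.1 (Equiv.Perm.SameCycle.symm a.2) hab

theorem BelowCyc.krewerasInv_eq {u : Equiv.Perm (Fin N)} (h : BelowCyc u) :
    krewerasInv (orbitPartition (u⁻¹ * cyc N)) = orbitPartition u := by
  rw [← h.kreweras_eq]
  exact kreweras_injOn.leftInvOn_invFunOn h.noncrossing

theorem orbitPartition_conj (g u : Equiv.Perm (Fin N)) (x y : Fin N) :
    orbitPartition (g * u * g⁻¹) (g x) (g y) ↔ orbitPartition u x y := by
  change (g * u * g⁻¹).SameCycle _ _ ↔ u.SameCycle _ _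
  rw [Equiv.Perm.sameCycle_conj]
  simp

theorem BelowCyc.conj_cyc_pow {u : Equiv.Perm (Fin N)} (h : BelowCyc u) (m : ℕ) :
    BelowCyc (cyc N ^ m * u * (cyc N ^ m)⁻¹) := by
  have h1 : (cyc N ^ m * u * (cyc N ^ m)⁻¹)⁻¹ * cyc N =
      cyc N ^ m * (u⁻¹ * cyc N) * (cyc N ^ m)⁻¹ := by
    have : (cyc N ^ m)⁻¹ * cyc N = cyc N * (cyc N ^ m)⁻¹ :=
      ((Commute.refl (cyc N)).pow_left m).inv_left.eq
    rw [mul_inv_rev, mul_inv_rev, inv_inv, mul_assoc, mul_assoc, this]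
    group
  rw [BelowCyc, h1, codim_conj, codim_conj]
  exact h

theorem BelowCyc.conj_eq_iff {u : Equiv.Perm (Fin N)} (h : BelowCyc u) (m : ℕ) :
    cyc N ^ m * u * (cyc N ^ m)⁻¹ = u ↔
      ∀ x y, orbitPartition u ((cyc N ^ m) x) ((cyc N ^ m) y) ↔ orbitPartition u x y := by
  constructor
  · intro he x y
    have := orbitPartition_conj (cyc N ^ m) u x y
    rwa [he] at this
  · intro hs
    refine (h.conj_cyc_pow m).eq_of_orbitPartition_eq h ?_
    ext x y
    obtain ⟨x, rfl⟩ := (cyc N ^ m).surjective x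
    obtain ⟨y, rfl⟩ := (cyc N ^ m).surjective y
    rw [orbitPartition_conj, hs]

end NoncrossingPerm

/-! ### Stacks of permutations and the type `A` map -/

section Stack

variable {N k : ℕ}

/-- The permutation of `[N] × [k]` that acts as `δ i` on the `i`-th copy of `[N]`. -/
def layers {X : Type*} (k : ℕ) : (Fin k → Equiv.Perm X) →* Equiv.Perm (X × Fin k) where
  toFun δ :=
    { toFun := fun p => (δ p.2 p.1, p.2)
      invFun := fun p => ((δ p.2)⁻¹ p.1, p.2)
      left_inv := fun p => by simp
      right_inv := fun p => by simp }
  map_one' := rfl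
  map_mul' _ _ := rfl

theorem layers_apply {X : Type*} (δ : Fin k → Equiv.Perm X) (p : X × Fin k) :
    layers k δ p = (δ p.2 p.1, p.2) := rfl

/-- The permutation of `[Nk]` that acts as `δ i` on the `i`-th of `k` interleaved copies of `[N]`. -/
def stack (N k : ℕ) : (Fin k → Equiv.Perm (Fin N)) →* Equiv.Perm (Fin (N * k)) :=
  (finProdFinEquiv : Fin N × Fin k ≃ Fin (N * k)).permCongrHom.toMonoidHom.comp (layers k)

theorem stack_eq (δ : Fin k → Equiv.Perm (Fin N)) :
    stack N k δ = finProdFinEquiv.permCongr (layers k δ) := rfl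

theorem stack_apply (δ : Fin k → Equiv.Perm (Fin N)) (j : Fin N) (i : Fin k) :
    stack N k δ (finProdFinEquiv (j, i)) = finProdFinEquiv (δ i j, i) := by
  rw [stack_eq, Equiv.permCongr_apply, Equiv.symm_apply_apply, layers_apply]

theorem stack_injective : Function.Injective (stack N k) := fun δ ε h => by
  funext i
  ext1 j
  have h1 := congrArg (fun u => u (finProdFinEquiv (j, i))) h
  simp only [stack_apply, EmbeddingLike.apply_eq_iff_eq, Prod.mk.injEq, and_true] at h1
  exact h1

theorem orbitPartition_stack (δ : Fin k → Equiv.Perm (Fin N)) :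
    orbitPartition (stack N k δ) = shuffleFin fun i => orbitPartition (δ i) := by
  ext x y
  obtain ⟨⟨j, i⟩, rfl⟩ := finProdFinEquiv.surjective x
  obtain ⟨⟨j', i'⟩, rfl⟩ := finProdFinEquiv.surjective y
  have h1 : ∀ p : Fin N × Fin k, toLex ((finProdFinEquiv p).divNat, (finProdFinEquiv p).modNat) =
      toLex p := fun p => congrArg toLex (finProdFinEquiv.symm_apply_apply p)
  have h2 : shuffleFin (fun i => orbitPartition (δ i)) (finProdFinEquiv (j, i))
      (finProdFinEquiv (j', i')) ↔ i = i' ∧ (δ i).SameCycle j j' := by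
    rw [shuffleFin, Setoid.comap_rel, h1, h1]
    rfl
  have h3 : ∀ z : ℤ, (stack N k δ ^ z) (finProdFinEquiv (j, i)) =
      finProdFinEquiv ((δ i ^ z) j, i) := fun z => by
    rw [← map_zpow, stack_apply, Pi.pow_apply]
  rw [h2]
  change (∃ z : ℤ, _) ↔ _
  simp only [h3, EmbeddingLike.apply_eq_iff_eq, Prod.mk.injEq]
  exact ⟨fun ⟨z, h, h'⟩ => ⟨h', z, h⟩, fun ⟨h', z, h⟩ => ⟨z, h, h'⟩⟩

theorem finrank_fixSub_layers {X : Type*} [Finite X] (δ : Fin k → Equiv.Perm X) :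
    finrank ℚ (fixSub (layers k δ)) = ∑ i, finrank ℚ (fixSub (δ i)) := by
  let e : fixSub (layers k δ) ≃ₗ[ℚ] (∀ i, fixSub (δ i)) :=
    { toFun := fun f i => ⟨fun j => f.1 (j, i), fun j => f.2 (j, i)⟩
      invFun := fun g => ⟨fun p => (g p.2).1 p.1, fun p => (g p.2).2 p.1⟩
      map_add' := fun _ _ => rfl
      map_smul' := fun _ _ => rfl
      left_inv := fun _ => rfl
      right_inv := fun _ => rfl }
  rw [e.finrank_eq, finrank_pi_fintype]

theorem codim_stack (δ : Fin k → Equiv.Perm (Fin N)) :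
    codim ⊤ (stack N k δ) = ∑ i, codim ⊤ (δ i) := by
  rw [stack_eq, codim_permCongr]
  have h1 := codim_top_add (layers k δ)
  rw [finrank_fixSub_layers] at h1
  have h2 : ∑ i, (codim ⊤ (δ i) + finrank ℚ (fixSub (δ i))) = ∑ _i : Fin k, N :=
    Finset.sum_congr rfl fun i _ => by rw [codim_top_add, Fintype.card_fin]
  rw [Finset.sum_add_distrib] at h2
  simp only [Fintype.card_prod, Fintype.card_fin, Finset.sum_const, Finset.card_univ,
    smul_eq_mul] at h1 h2
  rw [mul_comm] at h1
  omega

/-- A fixed function does not change on climbing a layer, so it is determined by its values on layer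
`0`, where one full turn acts as `u`. -/
theorem finrank_fixSub_helix {X : Type*} [Finite X] {w : Equiv.Perm (X × Fin (k + 1))}
    {u : Equiv.Perm X} (h1 : ∀ j (i : Fin k), w (j, i.castSucc) = (j, i.succ))
    (h2 : ∀ j, w (j, Fin.last k) = (u j, 0)) :
    finrank ℚ (fixSub w) = finrank ℚ (fixSub u) := by
  have hmap : fixSub w = (fixSub u).map (LinearMap.funLeft ℚ ℚ Prod.fst) := by
    ext f
    constructor
    · intro hf
      have h3 : ∀ j i, f (j, i) = f (j, 0) := fun j i => by
        induction i using Fin.induction with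
        | zero => rfl
        | succ i ih => rw [← h1, hf, ih]
      refine ⟨fun j => f (j, 0), fun j => ?_, funext fun p => (h3 p.1 p.2).symm⟩
      change f (u j, 0) = f (j, 0)
      rw [← h2, hf, h3]
    · rintro ⟨g, hg, rfl⟩ ⟨j, i⟩
      change g (w (j, i)).1 = g j
      induction i using Fin.lastCases with
      | last => rw [h2, hg]
      | cast i => rw [h1]
  rw [hmap]
  exact (Submodule.equivMapOfInjective _
    (LinearMap.funLeft_injective_of_surjective _ _ _ Prod.fst_surjective) _).finrank_eq.symm

theorem cyc_finProdFinEquiv_castSucc (j : Fin N) (i : Fin k) :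
    cyc (N * (k + 1)) (finProdFinEquiv (j, i.castSucc)) = finProdFinEquiv (j, i.succ) := by
  have h := (finProdFinEquiv (j, i.succ)).2
  apply Fin.ext
  rw [cyc_val]
  simp only [finProdFinEquiv_apply_val, Fin.val_castSucc, Fin.val_succ] at h ⊢
  rw [Nat.mod_eq_of_lt (by omega)]
  omega

theorem cyc_finProdFinEquiv_last (j : Fin N) :
    cyc (N * (k + 1)) (finProdFinEquiv (j, Fin.last k)) = finProdFinEquiv (cyc N j, 0) := by
  apply Fin.ext
  simp only [cyc_val, finProdFinEquiv_apply_val, Fin.val_last, Fin.val_zero, zero_add]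
  rw [← Nat.mul_mod_mul_left, mul_comm N]
  congr 1
  ring

/-- Rotation by a multiple of `k` preserves the interleaved copies; this relates the half-turns of
`[N]` and `[Nk]`. -/
theorem cyc_pow_mul (m : ℕ) : cyc (N * k) ^ (k * m) = stack N k fun _ => cyc N ^ m := by
  ext1 x
  obtain ⟨⟨j, i⟩, rfl⟩ := finProdFinEquiv.surjective x
  rw [stack_apply]
  apply Fin.ext
  simp only [cyc_pow_val, finProdFinEquiv_apply_val]
  have hk : 0 < k := i.pos
  rw [add_assoc, ← mul_add, mul_comm N k, Nat.mod_mul, Nat.add_mul_mod_self_left,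
    Nat.mod_eq_of_lt i.2, Nat.add_mul_div_left _ _ hk, Nat.div_eq_of_lt i.2, zero_add]

/-- The sequence `(π₂, …, π_k, c)`. -/
def nextPerm (π : Fin k → Equiv.Perm (Fin N)) (i : Fin k) : Equiv.Perm (Fin N) :=
  if h : (i : ℕ) + 1 < k then π ⟨i + 1, h⟩ else cyc N

/-- The delta sequence of a sequence of permutations. -/
def deltaPerm (π : Fin k → Equiv.Perm (Fin N)) (i : Fin k) : Equiv.Perm (Fin N) :=
  (π i)⁻¹ * nextPerm π i

/-- The permutation of `[Nk]` whose orbits form the image under the type `A` map. -/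
def nablaPerm (π : Fin k → Equiv.Perm (Fin N)) : Equiv.Perm (Fin (N * k)) :=
  cyc (N * k) * (stack N k (deltaPerm π))⁻¹

theorem nablaPerm_inv_mul_cyc (π : Fin k → Equiv.Perm (Fin N)) :
    (nablaPerm π)⁻¹ * cyc (N * k) = stack N k (deltaPerm π) := by
  rw [nablaPerm]
  group

theorem finrank_fixSub_nablaPerm (π : Fin (k + 1) → Equiv.Perm (Fin N)) :
    finrank ℚ (fixSub (nablaPerm π)) = finrank ℚ (fixSub (π 0)) := by
  -- In this conjugate, `π` at layer `i + 1` cancels the inverse of the next entry at layer `i`.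
  -- Past the last layer `c` cancels `c⁻¹`, leaving only `π 0`.
  have h0 : stack N (k + 1) π * nablaPerm π * (stack N (k + 1) π)⁻¹ =
      stack N (k + 1) π * cyc (N * (k + 1)) * (stack N (k + 1) (nextPerm π))⁻¹ := by
    have : deltaPerm π = π⁻¹ * nextPerm π := rfl
    rw [nablaPerm, this, map_mul, map_inv]
    group
  have h1 : finrank ℚ (fixSub (nablaPerm π)) =
      finrank ℚ (fixSub (stack N (k + 1) π * nablaPerm π * (stack N (k + 1) π)⁻¹)) :=
    (finrank_fixSub_permCongr (stack N (k + 1) π) _).symm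
  have hinv : ∀ j i, (stack N (k + 1) (nextPerm π))⁻¹ (finProdFinEquiv (j, i)) =
      finProdFinEquiv ((nextPerm π i)⁻¹ j, i) := fun j i => by
    rw [← map_inv, stack_apply, Pi.inv_apply]
  rw [h1, ← finrank_fixSub_permCongr finProdFinEquiv.symm, h0]
  refine finrank_fixSub_helix (fun j i => ?_) fun j => ?_
  · have hn : nextPerm π i.castSucc = π i.succ := by
      rw [nextPerm, dif_pos (by simp)]
      rfl
    rw [Equiv.permCongr_apply, Equiv.symm_symm, Equiv.Perm.mul_apply, hinv, hn,
      Equiv.Perm.mul_apply, cyc_finProdFinEquiv_castSucc, stack_apply]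
    simp
  · have hn : nextPerm π (Fin.last k) = cyc N := by
      rw [nextPerm, dif_neg (by simp)]
    rw [Equiv.permCongr_apply, Equiv.symm_symm, Equiv.Perm.mul_apply, hinv, hn,
      Equiv.Perm.mul_apply, cyc_finProdFinEquiv_last, stack_apply]
    simp

/-- A multichain corresponds to a minimal factorization of the long cycle of `[Nk]`. -/
theorem belowCyc_nablaPerm_iff (hN : 0 < N) (π : Fin (k + 1) → Equiv.Perm (Fin N)) :
    BelowCyc (nablaPerm π) ↔
      codim ⊤ (cyc N) = codim ⊤ (π 0) + ∑ i, codim ⊤ (deltaPerm π i) := by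
  rw [BelowCyc, nablaPerm_inv_mul_cyc, codim_stack]
  -- Both equations say that the delta lengths sum to the number of cycles of `π 0` minus one.
  have h1 := codim_top_add (nablaPerm π)
  have h2 := codim_top_add (π 0)
  have h3 := codim_cyc_add_one hN
  have h4 := codim_cyc_add_one (N := N * (k + 1)) (by positivity)
  rw [finrank_fixSub_nablaPerm] at h1
  rw [Fintype.card_fin] at h1 h2
  have h5 : N ≤ N * (k + 1) := Nat.le_mul_of_pos_right _ (by omega)
  omega

end Stack

/-! ### Additivity of lengths along chains -/

section Chains

variable {X : Type*} [Finite X]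

/-- The hypothesis makes the triangle inequality from `0` to `k` tight, so it is tight on every
subinterval. -/
theorem codim_chain (p : ℕ → Equiv.Perm X) (k : ℕ) (hk : codim ⊤ (p k) =
    codim ⊤ (p 0) + ∑ i ∈ Finset.range k, codim ⊤ ((p i)⁻¹ * p (i + 1))) {a b : ℕ} (hab : a ≤ b)
    (hb : b ≤ k) : codim ⊤ (p b) = codim ⊤ (p a) + codim ⊤ ((p a)⁻¹ * p b) := by
  have hstep : ∀ i, codim ⊤ (p (i + 1)) ≤ codim ⊤ (p i) + codim ⊤ ((p i)⁻¹ * p (i + 1)) :=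
    fun i => by simpa using codim_mul_le ⊤ (p i) ((p i)⁻¹ * p (i + 1))
  have hup : ∀ a b, a ≤ b → codim ⊤ (p b) ≤
      codim ⊤ (p a) + ∑ i ∈ Finset.Ico a b, codim ⊤ ((p i)⁻¹ * p (i + 1)) := by
    intro a b hab
    induction b, hab using Nat.le_induction with
    | base => simp
    | succ b hab ih =>
      rw [Finset.sum_Ico_succ_top hab]
      have := hstep b
      omega
  have hdiff : ∀ a b, a ≤ b → codim ⊤ ((p a)⁻¹ * p b) ≤
      ∑ i ∈ Finset.Ico a b, codim ⊤ ((p i)⁻¹ * p (i + 1)) := by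
    intro a b hab
    induction b, hab using Nat.le_induction with
    | base => simp [codim_one]
    | succ b hab ih =>
      rw [Finset.sum_Ico_succ_top hab]
      have := codim_mul_le ⊤ ((p a)⁻¹ * p b) ((p b)⁻¹ * p (b + 1))
      rw [mul_assoc, mul_inv_cancel_left] at this
      omega
  have h1 := hup 0 a (Nat.zero_le a)
  have h2 := hdiff a b hab
  have h3 := hup b k hb
  have h4 := codim_mul_le ⊤ (p a) ((p a)⁻¹ * p b)
  rw [mul_inv_cancel_left] at h4
  have h5 := Finset.sum_Ico_consecutive (fun i => codim ⊤ ((p i)⁻¹ * p (i + 1)))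
    (Nat.zero_le a) (hab.trans hb)
  have h6 := Finset.sum_Ico_consecutive (fun i => codim ⊤ ((p i)⁻¹ * p (i + 1))) hab hb
  rw [Finset.range_eq_Ico] at hk
  omega

end Chains

/-! ### Multichains and their delta sequences -/

section ChainsBelow

variable {N k : ℕ}

/-- The sequence `(π₁, …, π_k, c, c, …)`. -/
def extendPerm (π : Fin k → Equiv.Perm (Fin N)) (i : ℕ) : Equiv.Perm (Fin N) :=
  if h : i < k then π ⟨i, h⟩ else cyc N

theorem extendPerm_val (π : Fin k → Equiv.Perm (Fin N)) (i : Fin k) :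
    extendPerm π i = π i := dif_pos i.2

theorem extendPerm_self (π : Fin k → Equiv.Perm (Fin N)) : extendPerm π k = cyc N :=
  dif_neg (lt_irrefl k)

theorem deltaPerm_eq (π : Fin k → Equiv.Perm (Fin N)) (i : Fin k) :
    deltaPerm π i = (extendPerm π i)⁻¹ * extendPerm π (i + 1) := by
  rw [extendPerm_val]
  rfl

theorem sum_deltaPerm (π : Fin k → Equiv.Perm (Fin N)) : ∑ i, codim ⊤ (deltaPerm π i) =
    ∑ i ∈ Finset.range k, codim ⊤ ((extendPerm π i)⁻¹ * extendPerm π (i + 1)) := by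
  rw [← Fin.sum_univ_eq_sum_range fun i => codim ⊤ ((extendPerm π i)⁻¹ * extendPerm π (i + 1))]
  exact Finset.sum_congr rfl fun i _ => by rw [deltaPerm_eq]

/-- Multichains below the long cycle. -/
def IsMultichain (π : Fin k → Equiv.Perm (Fin N)) : Prop :=
  (∀ i, BelowCyc (π i)) ∧
    ∀ i j, i ≤ j → codim ⊤ (π j) = codim ⊤ (π i) + codim ⊤ ((π i)⁻¹ * π j)

theorem IsMultichain.codim_nextPerm {π : Fin k → Equiv.Perm (Fin N)} (h : IsMultichain π) (i : Fin k) :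
    codim ⊤ (nextPerm π i) = codim ⊤ (π i) + codim ⊤ (deltaPerm π i) := by
  rw [deltaPerm, nextPerm]
  split_ifs with h1
  · exact h.2 _ _ (Fin.le_def.2 (Nat.le_succ _))
  · exact h.1 i

theorem isMultichain_iff (hN : 0 < N) (hk : 0 < k) (π : Fin k → Equiv.Perm (Fin N)) :
    IsMultichain π ↔ BelowCyc (nablaPerm π) := by
  obtain ⟨k, rfl⟩ := Nat.exists_eq_succ_of_ne_zero hk.ne'
  rw [belowCyc_nablaPerm_iff hN, sum_deltaPerm]
  have h0 : π 0 = extendPerm π 0 := (extendPerm_val π 0).symm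
  constructor
  · intro h
    have h1 : ∀ m ≤ k + 1, codim ⊤ (extendPerm π m) = codim ⊤ (π 0) +
        ∑ i ∈ Finset.range m, codim ⊤ ((extendPerm π i)⁻¹ * extendPerm π (i + 1)) := by
      intro m hm
      induction m with
      | zero => simp [h0]
      | succ m ih =>
        have h2 := h.codim_nextPerm ⟨m, hm⟩
        rw [deltaPerm_eq, ← extendPerm_val π ⟨m, hm⟩] at h2
        rw [Finset.sum_range_succ, ← add_assoc, ← ih (by omega)]
        exact h2
    rw [← h1 _ le_rfl, extendPerm_self]
  · intro h
    rw [h0, ← extendPerm_self π] at h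
    have h1 := fun a b => codim_chain (extendPerm π) _ h (a := a) (b := b)
    refine ⟨fun i => ?_, fun i j hij => ?_⟩
    · have := h1 i _ i.2.le le_rfl
      rwa [extendPerm_self, extendPerm_val] at this
    · have := h1 i j hij j.2.le
      rwa [extendPerm_val, extendPerm_val] at this

theorem exists_deltaPerm_eq (δ : Fin k → Equiv.Perm (Fin N)) :
    ∃ π : Fin k → Equiv.Perm (Fin N), deltaPerm π = δ := by
  -- Solve backwards from `c`: `p m` is the entry `m` places before the final `c`. The default `1`
  -- can occur only for `k = 0`.
  let p : ℕ → Equiv.Perm (Fin N) := fun m =>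
    m.rec (cyc N) fun m q => q * (if h : k - 1 - m < k then δ ⟨k - 1 - m, h⟩ else 1)⁻¹
  refine ⟨fun i => p (k - i), funext fun i => ?_⟩
  have hnext : nextPerm (fun i : Fin k => p (k - i)) i = p (k - 1 - i) := by
    rw [nextPerm]
    split_ifs with h
    · exact congrArg p (by simp only; omega)
    · have : k - 1 - i = 0 := by omega
      rw [this]
      rfl
  have hp : p (k - i) = p (k - 1 - i) * (δ i)⁻¹ := by
    have h1 : k - i = k - 1 - i + 1 := by omega
    have h2 : (⟨k - 1 - (k - 1 - i), by omega⟩ : Fin k) = i := Fin.ext (by simp only; omega)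
    have h3 : p (k - 1 - i + 1) = p (k - 1 - i) * (if h : k - 1 - (k - 1 - i) < k then
      δ ⟨k - 1 - (k - 1 - i), h⟩ else 1)⁻¹ := rfl
    rw [h1, h3, dif_pos (by omega), h2]
  rw [deltaPerm, hnext, hp]
  group

theorem deltaPerm_injective : Function.Injective (deltaPerm (N := N) (k := k)) := by
  intro π μ h
  have key : ∀ m ≤ k, extendPerm π (k - m) = extendPerm μ (k - m) := by
    intro m hm
    induction m with
    | zero => rw [Nat.sub_zero, extendPerm_self, extendPerm_self]
    | succ m ih =>
      have h1 := congrFun h ⟨k - (m + 1), by omega⟩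
      rw [deltaPerm_eq, deltaPerm_eq] at h1
      have h2 : k - (m + 1) + 1 = k - m := by omega
      simp only [h2] at h1
      rw [ih (by omega)] at h1
      exact inv_injective (mul_right_cancel h1)
  funext i
  have := key (k - i) (Nat.sub_le _ _)
  rwa [Nat.sub_sub_self i.2.le, extendPerm_val, extendPerm_val] at this

theorem commute_stack_iff {δ : Fin k → Equiv.Perm (Fin N)} {g : Equiv.Perm (Fin N)} :
    Commute (stack N k fun _ => g) (stack N k δ) ↔ ∀ i, Commute g (δ i) := by
  simp only [commute_iff_eq, ← map_mul, stack_injective.eq_iff, funext_iff, Pi.mul_apply]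

theorem commute_nablaPerm_iff {π : Fin k → Equiv.Perm (Fin N)} {m : ℕ} :
    Commute (cyc (N * k) ^ (k * m)) (nablaPerm π) ↔ ∀ i, Commute (cyc N ^ m) (π i) := by
  have h0 : Commute (cyc (N * k) ^ (k * m)) (cyc (N * k)) := (Commute.refl _).pow_left _
  have h1 : Commute (cyc (N * k) ^ (k * m)) (nablaPerm π) ↔
      Commute (cyc (N * k) ^ (k * m)) (stack N k (deltaPerm π)) := by
    constructor
    · intro h
      rw [← nablaPerm_inv_mul_cyc]
      exact h.inv_right.mul_right h0
    · exact fun h => h0.mul_right h.inv_right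
  rw [h1, cyc_pow_mul, commute_stack_iff]
  have hc : Commute (cyc N ^ m) (cyc N) := (Commute.refl _).pow_left _
  constructor
  · intro h
    -- Descend from the last entry `c`, which commutes with its powers: each entry is the next one
    -- times an inverse delta.
    have key : ∀ a ≤ k, Commute (cyc N ^ m) (extendPerm π (k - a)) := by
      intro a ha
      induction a with
      | zero => rwa [Nat.sub_zero, extendPerm_self]
      | succ a ih =>
        have h2 := h ⟨k - (a + 1), by omega⟩
        rw [deltaPerm_eq] at h2
        have h3 : k - (a + 1) + 1 = k - a := by omega
        simp only [h3] at h2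
        have h4 := (ih (by omega)).mul_right h2.inv_right
        simpa using h4
    intro i
    have := key (k - i) (Nat.sub_le _ _)
    rwa [Nat.sub_sub_self i.2.le, extendPerm_val] at this
  · intro h i
    refine (h i).inv_right.mul_right ?_
    rw [nextPerm]
    split_ifs
    · exact h _
    · exact hc

end ChainsBelow

/-! ### Word lengths of signed permutations -/

section OddEven

variable {X : Type*}

/-- The functions that change sign under `a`. -/
def oddSub (a : Equiv.Perm X) : Submodule ℚ (X → ℚ) where
  carrier := {f | ∀ x, f (a x) = -f x}
  add_mem' hf hg x := by simp [hf x, hg x, add_comm]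
  zero_mem' x := by simp
  smul_mem' c f hf x := by simp [hf x]

/-- Split `f` into the halves of `f + f ∘ a` and `f - f ∘ a`. -/
theorem finrank_eq_even_add_odd [Finite X] {a : Equiv.Perm X} (ha : a * a = 1)
    {S : Submodule ℚ (X → ℚ)} (hS : ∀ f ∈ S, f ∘ a ∈ S) :
    finrank ℚ S = finrank ℚ (S ⊓ fixSub a : Submodule ℚ (X → ℚ)) +
      finrank ℚ (S ⊓ oddSub a : Submodule ℚ (X → ℚ)) := by
  have haa : ∀ x, a (a x) = x := fun x => congrArg (fun u => u x) ha
  have h1 := Submodule.finrank_sup_add_finrank_inf_eq (S ⊓ fixSub a) (S ⊓ oddSub a)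
  have h2 : (S ⊓ fixSub a) ⊓ (S ⊓ oddSub a) = ⊥ := by
    rw [eq_bot_iff]
    rintro f ⟨⟨-, hf⟩, -, hf'⟩
    ext x
    have := (hf x).symm.trans (hf' x)
    simp only [Pi.zero_apply]
    linarith
  have h3 : (S ⊓ fixSub a) ⊔ (S ⊓ oddSub a) = S := by
    refine le_antisymm (sup_le inf_le_left inf_le_left) fun f hf => ?_
    have h4 := hS f hf
    refine Submodule.mem_sup.2 ⟨(2⁻¹ : ℚ) • (f + f ∘ a), ⟨S.smul_mem _ (S.add_mem hf h4), ?_⟩,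
      (2⁻¹ : ℚ) • (f - f ∘ a), ⟨S.smul_mem _ (S.sub_mem hf h4), ?_⟩, ?_⟩
    · intro x
      simp [haa, add_comm]
    · intro x
      simp only [Pi.smul_apply, Pi.sub_apply, Function.comp_apply, haa, smul_eq_mul]
      ring
    · ext x
      simp only [Pi.smul_apply, Pi.sub_apply, Pi.add_apply, Function.comp_apply, smul_eq_mul]
      ring
  rw [h2, h3, finrank_bot] at h1
  exact h1

theorem codim_eq_even_add_odd [Finite X] {a w : Equiv.Perm X} (ha : a * a = 1)
    (hw : Commute a w) : codim ⊤ w = codim (fixSub a) w + codim (oddSub a) w := by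
  have h1 := finrank_eq_even_add_odd ha (S := ⊤) fun _ _ => trivial
  have h2 := finrank_eq_even_add_odd ha (S := fixSub w) fun f hf x => by
    have : a (w x) = w (a x) := congrArg (fun u => u x) hw.eq
    rw [Function.comp_apply, this, hf, Function.comp_apply]
  have h3 := codim_add (fixSub a) w
  have h4 := codim_add (oddSub a) w
  have h5 := codim_add ⊤ w
  rw [top_inf_eq, top_inf_eq] at h1
  rw [inf_top_eq] at h5
  omega

end OddEven

/-! ### Comparison of the absolute orders of types B and A -/

section TypeB

variable {n : ℕ}

theorem antipode_eq (n : ℕ) : antipode (2 * n) = cyc (2 * n) ^ n := by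
  rw [antipode, Nat.mul_div_cancel_left n two_pos]
  rfl

theorem antipode_val (x : Fin (2 * n)) : (antipode (2 * n) x : ℕ) = (x + n) % (2 * n) := by
  rw [antipode_eq, cyc_pow_val]

theorem antipode_mul_self : antipode (2 * n) * antipode (2 * n) = 1 := by
  ext x
  rw [antipode_eq, ← pow_add, cyc_pow_val, ← two_mul, Nat.add_mod_right, Nat.mod_eq_of_lt x.2]
  rfl

theorem antipode_antipode (x : Fin (2 * n)) : antipode (2 * n) (antipode (2 * n) x) = x :=
  congrArg (fun u => u x) antipode_mul_self

theorem antipode_ne (x : Fin (2 * n)) : antipode (2 * n) x ≠ x := fun h => by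
  have h1 := congrArg Fin.val h
  have h2 := x.2
  rw [antipode_val] at h1
  rcases Nat.lt_or_ge (x + n) (2 * n) with h3 | h3
  · rw [Nat.mod_eq_of_lt h3] at h1
    omega
  · rw [Nat.mod_eq_sub_mod h3, Nat.mod_eq_of_lt (by omega)] at h1
    omega

theorem mem_signedPerm {w : Equiv.Perm (Fin (2 * n))} :
    w ∈ signedPerm n ↔ Commute (antipode (2 * n)) w := by
  rw [signedPerm, Subgroup.mem_centralizer_singleton_iff, commute_iff_eq, eq_comm]

theorem antipode_apply_comm {w : Equiv.Perm (Fin (2 * n))} (hw : w ∈ signedPerm n)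
    (x : Fin (2 * n)) : antipode (2 * n) (w x) = w (antipode (2 * n) x) :=
  congrArg (fun u => u x) (mem_signedPerm.1 hw).eq

theorem conj_swap (i j : Fin (2 * n)) : antipode (2 * n) * Equiv.swap i j =
    Equiv.swap (antipode (2 * n) i) (antipode (2 * n) j) * antipode (2 * n) := by
  rw [Equiv.swap_apply_apply, inv_mul_cancel_right]

theorem swap_antipode_mem (i : Fin (2 * n)) :
    Equiv.swap i (antipode (2 * n) i) ∈ signedPerm n := by
  rw [mem_signedPerm, commute_iff_eq, conj_swap, antipode_antipode, Equiv.swap_comm]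

theorem swap_mul_swap_commute {i j : Fin (2 * n)} (h : j ≠ i) (h' : j ≠ antipode (2 * n) i) :
    Commute (Equiv.swap i j) (Equiv.swap (antipode (2 * n) i) (antipode (2 * n) j)) := by
  refine Equiv.Perm.Disjoint.commute fun x => ?_
  by_contra hcon
  push Not at hcon
  have h1 : x = i ∨ x = j := by
    by_contra hx
    push Not at hx
    exact hcon.1 (Equiv.swap_apply_of_ne_of_ne hx.1 hx.2)
  refine hcon.2 (Equiv.swap_apply_of_ne_of_ne ?_ ?_) <;> rcases h1 with rfl | rfl
  · exact (antipode_ne x).symm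
  · exact h'
  · rintro hx
    exact h' (by rw [hx, antipode_antipode])
  · exact (antipode_ne x).symm

theorem swap_mul_swap_mem {i j : Fin (2 * n)} (h : j ≠ i) (h' : j ≠ antipode (2 * n) i) :
    Equiv.swap i j * Equiv.swap (antipode (2 * n) i) (antipode (2 * n) j) ∈ signedPerm n := by
  rw [mem_signedPerm, commute_iff_eq, ← mul_assoc, conj_swap, mul_assoc, conj_swap,
    antipode_antipode, antipode_antipode, ← mul_assoc, (swap_mul_swap_commute h h').eq]

theorem fixSub_inf_le_mul {X : Type*} (u v : Equiv.Perm X) :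
    fixSub u ⊓ fixSub v ≤ fixSub (u * v) :=
  fun _ hf x => (hf.1 (v x)).trans (hf.2 x)

theorem mem_fixSub_swap_mul_swap {i j : Fin (2 * n)} {f : Fin (2 * n) → ℚ} (h : f i = f j)
    (hf : f ∈ oddSub (antipode (2 * n))) :
    f ∈ fixSub (Equiv.swap i j * Equiv.swap (antipode (2 * n) i) (antipode (2 * n) j)) :=
  fixSub_inf_le_mul _ _ ⟨mem_fixSub_swap h, mem_fixSub_swap (by rw [hf, hf, h])⟩

/-- After multiplication by `t`, both `x` and its antipode are fixed points, so the difference of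
their delta functions is a newly fixed odd function. -/
theorem codim_lt_of_reflection {w t : Equiv.Perm (Fin (2 * n))} (hw : w ∈ signedPerm n)
    (ht : t ∈ signedPerm n) {x : Fin (2 * n)} (hx : w x ≠ x) (htw : t (w x) = x)
    (hfix : ∀ f ∈ oddSub (antipode (2 * n)), f x = f (w x) → f ∈ fixSub t) :
    codim (oddSub (antipode (2 * n))) (t * w) < codim (oddSub (antipode (2 * n))) w := by
  have h2 : (t * w) (antipode (2 * n) x) = antipode (2 * n) x := by
    rw [← antipode_apply_comm ((signedPerm n).mul_mem ht hw), Equiv.Perm.mul_apply, htw]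
  refine codim_lt ?_ (Pi.single x 1 - Pi.single (antipode (2 * n) x) 1) ?_
    (sub_mem (single_mem_fixSub htw) (single_mem_fixSub h2)) ?_
  · rintro f ⟨hf, hodd⟩
    exact fixSub_inf_le_mul _ _ ⟨hfix f hodd (hf x).symm, hf⟩
  · intro z
    have e1 : antipode (2 * n) z = x ↔ z = antipode (2 * n) x := by
      rw [← (antipode (2 * n)).injective.eq_iff, antipode_antipode]
    simp only [Pi.sub_apply, Pi.single_apply, e1, EmbeddingLike.apply_eq_iff_eq]
    ring
  · intro h
    have h3 := h x
    simp only [Pi.sub_apply, Pi.single_apply, hx, if_false, if_true,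
      (antipode_ne x).symm] at h3
    split_ifs at h3 <;> norm_num at h3

theorem mul_self_of_commute {M : Type*} [Monoid M] {s t : M} (h : Commute s t) (hs : s * s = 1)
    (ht : t * t = 1) : s * t * (s * t) = 1 := by
  rw [h.symm.mul_mul_mul_comm, hs, ht, one_mul]

theorem wordLength_reflB_aux (w : signedPerm n) :
    wordLength (reflB n) w = codim (oddSub (antipode (2 * n))) w.1 ∧ ∃ l : List (signedPerm n),
      (∀ t ∈ l, t ∈ reflB n) ∧ l.length = codim (oddSub (antipode (2 * n))) w.1 ∧ l.prod = w := by
  refine wordLength_eq (r := fun w : signedPerm n => codim (oddSub (antipode (2 * n))) w.1)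
    (codim_one _) (fun u v => codim_mul_le _ u.1 v.1) ?_ ?_ w
  · rintro t (⟨i, ht⟩ | ⟨i, j, -, -, ht⟩) <;> simp only [ht]
    · exact codim_le_one i _ fun f _ hf => mem_fixSub_swap hf
    · exact codim_le_one i j fun f hodd hf => mem_fixSub_swap_mul_swap hf hodd
  · intro w hw
    obtain ⟨x, hx⟩ : ∃ x, w.1 x ≠ x := by
      by_contra h
      push Not at h
      exact hw (Subtype.ext (Equiv.ext h))
    by_cases h : w.1 x = antipode (2 * n) x
    · refine ⟨⟨_, swap_antipode_mem x⟩, .inl ⟨x, rfl⟩, Subtype.ext (Equiv.swap_mul_self _ _), ?_⟩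
      refine codim_lt_of_reflection w.2 (swap_antipode_mem x) hx ?_ fun f _ hf => ?_
      · rw [h, Equiv.swap_apply_right]
      · exact mem_fixSub_swap (hf.trans (congrArg f h))
    · have h1 := swap_mul_swap_mem hx h
      refine ⟨⟨_, h1⟩, .inr ⟨x, w.1 x, hx, h, rfl⟩, Subtype.ext ?_, ?_⟩
      · exact mul_self_of_commute (swap_mul_swap_commute hx h) (Equiv.swap_mul_self _ _)
          (Equiv.swap_mul_self _ _)
      · refine codim_lt_of_reflection w.2 h1 hx ?_ fun f hodd hf => ?_
        · rw [Equiv.Perm.mul_apply, Equiv.swap_apply_of_ne_of_ne h (antipode_ne _).symm,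
            Equiv.swap_apply_right]
        · exact mem_fixSub_swap_mul_swap hf hodd

/-- Each reflection of type B is a product of at most two transpositions. -/
theorem codim_le_two_mul (w : signedPerm n) :
    codim ⊤ w.1 ≤ 2 * codim (oddSub (antipode (2 * n))) w.1 := by
  obtain ⟨l, hl, hlen, hprod⟩ := (wordLength_reflB_aux w).2
  rw [← hlen, ← hprod]
  clear hlen hprod
  induction l with
  | nil => simp [codim_one]
  | cons t l ih =>
    have h1 := ih fun s hs => hl s (by simp [hs])
    have h2 : codim ⊤ t.1 ≤ 2 := by
      rcases hl t (by simp) with ⟨i, ht⟩ | ⟨i, j, -, -, ht⟩ <;> rw [ht]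
      · exact (codim_swap_le _ _).trans one_le_two
      · exact (codim_mul_le _ _ _).trans (add_le_add (codim_swap_le _ _) (codim_swap_le _ _))
    have h3 := codim_mul_le ⊤ t.1 l.prod.1
    rw [List.prod_cons, List.length_cons, Subgroup.coe_mul]
    omega

theorem absLE_reflB {u v : signedPerm n} :
    AbsLE (reflB n) u v ↔ codim (oddSub (antipode (2 * n))) v.1 =
      codim (oddSub (antipode (2 * n))) u.1 + codim (oddSub (antipode (2 * n))) (u.1⁻¹ * v.1) := by
  simp only [AbsLE, fun w : signedPerm n => (wordLength_reflB_aux w).1]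
  rfl

/-- Even and odd codimensions are each subadditive; if their sum is additive, so is each of them. -/
theorem absLE_reflB_of_reflA {u v : signedPerm n} (h : AbsLE (reflA (2 * n)) u.1 v.1) :
    AbsLE (reflB n) u v := by
  rw [absLE_reflA] at h
  rw [absLE_reflB]
  have key := fun w : signedPerm n =>
    codim_eq_even_add_odd antipode_mul_self (mem_signedPerm.1 w.2)
  have h1 := key u
  have h2 := key v
  have h3 : _ = codim _ (u.1⁻¹ * v.1) + codim _ (u.1⁻¹ * v.1) := key (u⁻¹ * v)
  have h4 := codim_mul_le (fixSub (antipode (2 * n))) u.1 (u.1⁻¹ * v.1)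
  have h5 := codim_mul_le (oddSub (antipode (2 * n))) u.1 (u.1⁻¹ * v.1)
  have h6 : codim ⊤ (u⁻¹ * v).1 = codim ⊤ (u.1⁻¹ * v.1) := rfl
  rw [mul_inv_cancel_left] at h4 h5
  omega

/-- The signed permutations with at most one cycle that is its own antipode. -/
def NearlyPaired (w : signedPerm n) : Prop :=
  2 * codim (oddSub (antipode (2 * n))) w.1 ≤ codim ⊤ w.1 + 1

theorem NearlyPaired.split {u v : signedPerm n} (hv : NearlyPaired v) (h : AbsLE (reflB n) u v) :
    AbsLE (reflA (2 * n)) u.1 v.1 ∧ NearlyPaired u ∧ NearlyPaired (u⁻¹ * v) := by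
  rw [absLE_reflB] at h
  have h1 := codim_le_two_mul u
  have h2 := codim_le_two_mul (u⁻¹ * v)
  have h3 := codim_mul_le ⊤ u.1 (u⁻¹ * v).1
  have h4 : u.1 * (u⁻¹ * v).1 = v.1 := mul_inv_cancel_left _ _
  have h5 : codim (oddSub (antipode (2 * n))) (u⁻¹ * v).1 =
    codim (oddSub (antipode (2 * n))) (u.1⁻¹ * v.1) := rfl
  have h6 : Equiv.Perm.sign v.1 = Equiv.Perm.sign u.1 * Equiv.Perm.sign (u⁻¹ * v).1 := by
    rw [← map_mul, h4]
  rw [sign_eq_codim, sign_eq_codim, sign_eq_codim, ← pow_add] at h6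
  rw [h4] at h3
  -- The sum of the two codimensions lies between `codim ⊤ v.1` and that number plus one. The sign
  -- excludes the larger value.
  have h7 : codim ⊤ u.1 + codim ⊤ (u⁻¹ * v).1 ≠ codim ⊤ v.1 + 1 := fun h => by
    rw [h, pow_succ] at h6
    exact absurd (mul_eq_left.1 h6.symm) (by decide)
  rw [absLE_reflA]
  have h8 : codim ⊤ (u⁻¹ * v).1 = codim ⊤ (u.1⁻¹ * v.1) := rfl
  unfold NearlyPaired at *
  omega

theorem finrank_oddSub_le : finrank ℚ (oddSub (antipode (2 * n))) ≤ n := by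
  let r : oddSub (antipode (2 * n)) →ₗ[ℚ] (Fin n → ℚ) :=
    (LinearMap.funLeft ℚ ℚ (Fin.castLE (Nat.le_mul_of_pos_left n two_pos))).comp
      (oddSub (antipode (2 * n))).subtype
  have hr : Function.Injective r := by
    rw [← LinearMap.ker_eq_bot, eq_bot_iff]
    intro f hf
    have h0 : ∀ i : Fin n, f.1 (Fin.castLE (Nat.le_mul_of_pos_left n two_pos) i) = 0 :=
      fun i => congrFun (LinearMap.mem_ker.1 hf) i
    refine Subtype.ext (funext fun x => ?_)
    rcases Nat.lt_or_ge x n with h | h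
    · exact h0 ⟨x, h⟩
    · have h1 : x = antipode (2 * n)
          (Fin.castLE (Nat.le_mul_of_pos_left n two_pos) ⟨x - n, by omega⟩) := by
        apply Fin.ext
        rw [antipode_val, Fin.val_castLE, Nat.sub_add_cancel h, Nat.mod_eq_of_lt x.2]
      rw [h1, f.2, h0, neg_zero]
      rfl
  simpa using LinearMap.finrank_le_finrank_of_injective hr

theorem nearlyPaired_cycB (hn : 0 < n) : NearlyPaired (cycB n) := by
  have h1 := codim_cyc_add_one (N := 2 * n) (by omega)
  have h2 := finrank_oddSub_le (n := n)
  have h3 := codim_add (oddSub (antipode (2 * n))) (cycB n).1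
  have h4 : codim ⊤ (cycB n).1 = codim ⊤ (cyc (2 * n)) := rfl
  rw [NearlyPaired]
  omega

theorem absLE_reflB_iff {u v : signedPerm n} (hv : NearlyPaired v) :
    AbsLE (reflB n) u v ↔ AbsLE (reflA (2 * n)) u.1 v.1 :=
  ⟨fun h => (hv.split h).1, absLE_reflB_of_reflA⟩

end TypeB

/-! ### Divisibility of the block sizes -/

section Divisible

variable {N k : ℕ}

theorem orbitPartition_step_modEq {M : ℕ} {w : Equiv.Perm (Fin M)}
    (h : ∀ x, (w x : ℕ) ≡ x + 1 [MOD k]) : Divisible k (orbitPartition w) := by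
  rintro _ ⟨x, rfl⟩
  have h1 : ∀ m : ℕ, ((w ^ m) x : ℕ) ≡ x + m [MOD k] := fun m => by
    induction m with
    | zero => rfl
    | succ m ih =>
      rw [pow_succ', Equiv.Perm.mul_apply]
      exact (h _).trans (ih.add_right 1)
  have h2 : {y | orbitPartition w y x} = MulAction.orbit (Subgroup.zpowers w) x := by
    ext y
    constructor
    · intro hy
      obtain ⟨i, hi⟩ := Equiv.Perm.SameCycle.symm hy
      exact ⟨⟨w ^ i, i, rfl⟩, hi⟩
    · rintro ⟨⟨_, i, rfl⟩, hi⟩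
      exact Equiv.Perm.SameCycle.symm ⟨i, hi⟩
  have := Fintype.ofFinite (MulAction.orbit (Subgroup.zpowers w) x)
  rw [h2, ← Nat.card_coe_set_eq, Nat.card_eq_fintype_card, ← MulAction.minimalPeriod_eq_card]
  have h3 := h1 (Function.minimalPeriod (w • ·) x)
  have h4 : (w ^ Function.minimalPeriod (w • ·) x) x = x :=
    (MulAction.pow_smul_eq_iff_minimalPeriod_dvd (a := w) (b := x)).2 dvd_rfl
  rw [h4] at h3
  -- Going once round the orbit returns to `x` while adding the orbit size mod `k`.
  exact (Nat.modEq_zero_iff_dvd).1 (Nat.ModEq.add_left_cancel' _ h3.symm)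

theorem Divisible.dvd_ncard {M : ℕ} {P : Setoid (Fin M)} (hP : Divisible k P) {S : Set (Fin M)}
    (hS : ∀ a b, P a b → a ∈ S → b ∈ S) : k ∣ S.ncard := by
  classical
  have := Fintype.ofFinite (Quotient P)
  rw [Set.ncard_eq_toFinset_card', Finset.card_eq_sum_card_fiberwise
    (f := fun x => (Quotient.mk P x)) (t := Finset.univ) fun _ _ => Finset.mem_univ _]
  refine Finset.dvd_sum fun q _ => ?_
  induction q using Quotient.ind with | _ x
  by_cases hx : x ∈ S
  · have h1 := hP _ (P.mem_classes x)
    rw [Set.ncard_eq_toFinset_card'] at h1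
    refine h1.trans (dvd_of_eq ?_)
    congr 1
    ext y
    simp only [Finset.mem_filter, Set.mem_toFinset, Quotient.eq, Set.mem_ofPred_eq]
    exact ⟨fun h => ⟨hS x y (P.symm' h) hx, h⟩, fun h => h.2⟩
  · rw [Finset.card_eq_zero.2]
    · exact dvd_zero k
    · ext y
      simp only [Finset.mem_filter, Set.mem_toFinset, Quotient.eq, Finset.notMem_empty, iff_false]
      exact fun h => hx (hS y x h.2 h.1)

/-- The interval between `i` and `j` is a union of blocks, so its size `j - i` is a multiple of `k`.
-/
theorem Divisible.modEq_of_krewerasAux {M : ℕ} {P : Setoid (Fin M)} (hP : Divisible k P)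
    {i j : Fin M} (h : krewerasAux P i j) : (i : ℕ) ≡ j [MOD k] := by
  wlog hij : i ≤ j generalizing i j
  · exact (this (Setoid.symm' _ h) (le_of_not_ge hij)).symm
  have h1 : k ∣ (Set.Ioc i j).ncard := hP.dvd_ncard fun a b hab => by
    have h2 := h a b hab
    simp only [Set.mem_Ioc, Fin.le_def, Fin.lt_def] at h2 hij ⊢
    omega
  rw [Set.ncard_eq_toFinset_card', Set.toFinset_Ioc, Fin.card_Ioc] at h1
  exact (Nat.modEq_iff_dvd' hij).2 h1

theorem stack_val_modEq (δ : Fin k → Equiv.Perm (Fin N)) (x : Fin (N * k)) :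
    (stack N k δ x : ℕ) ≡ x [MOD k] := by
  obtain ⟨⟨j, i⟩, rfl⟩ := finProdFinEquiv.surjective x
  rw [stack_apply]
  simp [Nat.ModEq]

/-- Residues mod `k` label the interleaved copies, so `d` maps each copy to itself. -/
theorem exists_stack_eq {d : Equiv.Perm (Fin (N * k))} (hd : ∀ x, (d x : ℕ) ≡ x [MOD k]) :
    ∃ δ, stack N k δ = d := by
  have hmod : ∀ j i, (d (finProdFinEquiv (j, i))).modNat = i := fun j i => Fin.ext <| by
    have h1 := hd (finProdFinEquiv (j, i))
    rw [Fin.coe_modNat, h1, finProdFinEquiv_apply_val]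
    simp [Nat.mod_eq_of_lt i.2]
  have heq : ∀ j i, finProdFinEquiv ((d (finProdFinEquiv (j, i))).divNat, i) =
      d (finProdFinEquiv (j, i)) := fun j i => by
    have := finProdFinEquiv.apply_symm_apply (d (finProdFinEquiv (j, i)))
    rwa [finProdFinEquiv_symm_apply, hmod] at this
  have hinj : ∀ i, Function.Injective fun j => (d (finProdFinEquiv (j, i))).divNat := by
    intro i j j' h
    have h1 := heq j i
    simp only at h
    rw [h, heq j' i] at h1
    simpa using h1.symm
  refine ⟨fun i => Equiv.ofBijective _ (Finite.injective_iff_bijective.1 (hinj i)), ?_⟩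
  ext1 x
  obtain ⟨⟨j, i⟩, rfl⟩ := finProdFinEquiv.surjective x
  rw [stack_apply]
  exact heq j i

theorem divisible_nablaPerm (π : Fin k → Equiv.Perm (Fin N)) :
    Divisible k (orbitPartition (nablaPerm π)) := by
  refine orbitPartition_step_modEq fun x => ?_
  rw [nablaPerm, Equiv.Perm.mul_apply, cyc_val, ← map_inv]
  have h1 := stack_val_modEq (deltaPerm π)⁻¹ x
  exact ((Nat.mod_modEq _ _).of_mul_left N).trans (h1.add_right 1)

/-- Every noncrossing partition all of whose block sizes are divisible by `k` comes from a sequence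
of permutations. -/
theorem exists_nablaPerm {P : Setoid (Fin (N * k))} (hP : Noncrossing P) (hk : Divisible k P) :
    ∃ π, BelowCyc (nablaPerm (N := N) (k := k) π) ∧ orbitPartition (nablaPerm π) = P := by
  obtain ⟨w, hw, rfl⟩ := exists_belowCyc hP
  obtain ⟨δ, hδ⟩ := exists_stack_eq (d := w⁻¹ * cyc (N * k)) fun x =>
    (hk.modEq_of_krewerasAux (belowCyc_iff.1 hw x)).symm
  obtain ⟨π, rfl⟩ := exists_deltaPerm_eq δ
  have : nablaPerm π = w := by
    rw [nablaPerm, hδ]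
    group
  exact ⟨π, this ▸ hw, by rw [this]⟩

theorem IsMultichain.classicalDelta_eq {π : Fin k → Equiv.Perm (Fin N)} (h : IsMultichain π)
    (i : Fin k) :
    classicalDelta (fun i => orbitPartition (π i)) i = orbitPartition (deltaPerm π i) := by
  rw [classicalDelta, deltaPerm, nextPerm]
  split_ifs with h1
  · exact (h.1 _).relKreweras_eq (h.2 _ _ (Fin.le_def.2 (Nat.le_succ _)))
  · exact (h.1 i).kreweras_eq

theorem IsMultichain.shuffleFin_eq {π : Fin k → Equiv.Perm (Fin N)} (h : IsMultichain π) :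
    shuffleFin (classicalDelta fun i => orbitPartition (π i)) =
      orbitPartition ((nablaPerm π)⁻¹ * cyc (N * k)) := by
  rw [nablaPerm_inv_mul_cyc, orbitPartition_stack]
  exact congrArg shuffleFin (funext h.classicalDelta_eq)

theorem sum_eq_sum_add_sum_iff {ι : Type*} [Fintype ι] {a b c : ι → ℕ}
    (h : ∀ i, a i ≤ b i + c i) : ∑ i, a i = ∑ i, b i + ∑ i, c i ↔ ∀ i, a i = b i + c i := by
  rw [← Finset.sum_add_distrib, Finset.sum_eq_sum_iff_of_le fun i _ => h i]
  simp

/-- Passing to Kreweras complements reverses refinement and leaves the stacked deltas. Their lengths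
are sums over the copies, and subadditivity in each copy turns one equality of sums into `k`
equalities. -/
theorem orbitPartition_nablaPerm_le_iff {π μ : Fin k → Equiv.Perm (Fin N)}
    (hπ : BelowCyc (nablaPerm π)) (hμ : BelowCyc (nablaPerm μ)) :
    orbitPartition (nablaPerm π) ≤ orbitPartition (nablaPerm μ) ↔
      ∀ i, AbsLE (reflA N) (deltaPerm μ i) (deltaPerm π i) := by
  rw [← krewerasAux_le_iff hπ.noncrossing hμ.noncrossing, hπ.krewerasAux_eq, hμ.krewerasAux_eq,
    ← hμ.inv_mul_cyc.codim_add_iff hπ.inv_mul_cyc, nablaPerm_inv_mul_cyc, nablaPerm_inv_mul_cyc,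
    ← map_inv, ← map_mul, codim_stack, codim_stack, codim_stack, sum_eq_sum_add_sum_iff]
  · simp only [absLE_reflA]
    rfl
  · intro i
    simpa using codim_mul_le ⊤ (deltaPerm μ i) ((deltaPerm μ i)⁻¹ * deltaPerm π i)

end Divisible

/-! ### Noncrossing partitions of type `B` -/

section SymmetricNC

variable {n k : ℕ}

theorem mem_signedPerm_iff_conj {w : Equiv.Perm (Fin (2 * n))} :
    w ∈ signedPerm n ↔ cyc (2 * n) ^ n * w * (cyc (2 * n) ^ n)⁻¹ = w := by
  rw [mem_signedPerm, antipode_eq, commute_iff_eq, mul_inv_eq_iff_eq_mul]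

theorem absLE_cycB_iff (hn : 0 < n) {w : signedPerm n} :
    AbsLE (reflB n) w (cycB n) ↔ BelowCyc w.1 := by
  rw [absLE_reflB_iff (nearlyPaired_cycB hn), belowCyc_iff_absLE]
  rfl

theorem absLE_reflB_one_left (w : signedPerm n) : AbsLE (reflB n) 1 w :=
  absLE_reflB_of_reflA (absLE_one_left _)

theorem NCGroup.belowCyc {N : ℕ} (w : NCGroup (reflA N) (cyc N)) : BelowCyc w.1 :=
  belowCyc_iff_absLE.2 w.2.2

theorem NCGroup.le_iff {N : ℕ} {u v : NCGroup (reflA N) (cyc N)} :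
    u ≤ v ↔ orbitPartition u.1 ≤ orbitPartition v.1 := by
  rw [← u.belowCyc.codim_add_iff v.belowCyc, ← absLE_reflA]
  rfl

theorem NCGroup.nearlyPaired (hn : 0 < n) (w : NCGroup (reflB n) (cycB n)) : NearlyPaired w.1 :=
  ((nearlyPaired_cycB hn).split w.2.2).2.1

/-- The embedding of `NC(B_n)` into `NC(A_{2n-1})`. -/
def typeBEmbedding (hn : 0 < n) :
    NCGroup (reflB n) (cycB n) ↪o NCGroup (reflA (2 * n)) (cyc (2 * n)) where
  toFun w := ⟨w.1.1, absLE_one_left _, belowCyc_iff_absLE.1 ((absLE_cycB_iff hn).1 w.2.2)⟩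
  inj' _ _ h := Subtype.ext (Subtype.ext
    (congrArg (fun w : NCGroup (reflA (2 * n)) (cyc (2 * n)) => w.1) h))
  map_rel_iff' {_ v} := (absLE_reflB_iff (v.nearlyPaired hn)).symm

theorem typeBEmbedding_coe (hn : 0 < n) (w : NCGroup (reflB n) (cycB n)) :
    (typeBEmbedding hn w).1 = w.1.1 := rfl

theorem exists_typeBEmbedding_eq (hn : 0 < n) {w : NCGroup (reflA (2 * n)) (cyc (2 * n))}
    (hw : w.1 ∈ signedPerm n) : ∃ v, typeBEmbedding hn v = w :=
  ⟨⟨⟨w.1, hw⟩, absLE_reflB_one_left _, (absLE_cycB_iff hn).2 w.belowCyc⟩, rfl⟩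

theorem mem_range_typeBEmbedding (hn : 0 < n) {w : NCGroup (reflA (2 * n)) (cyc (2 * n))} :
    w ∈ Set.range (typeBEmbedding hn) ↔ cyc (2 * n) ^ n * w.1 * (cyc (2 * n) ^ n)⁻¹ = w.1 := by
  rw [← mem_signedPerm_iff_conj]
  refine ⟨?_, exists_typeBEmbedding_eq hn⟩
  rintro ⟨v, rfl⟩
  exact v.1.2

theorem orbitPartition_antipode (w : signedPerm n) (x y : Fin (2 * n)) :
    orbitPartition w.1 (antipode _ x) (antipode _ y) ↔ orbitPartition w.1 x y := by
  have h := orbitPartition_conj (antipode (2 * n)) w.1 x y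
  have h1 : antipode (2 * n) * w.1 * (antipode (2 * n))⁻¹ = w.1 := by
    rw [antipode_eq]
    exact mem_signedPerm_iff_conj.1 w.2
  rwa [h1] at h

/-- A permutation below `c` is determined by its orbits, so symmetry of the partition makes it
commute with the half-turn. -/
theorem exists_typeB_orbitPartition (hn : 0 < n) {P : Setoid (Fin (2 * n))} (hP : Noncrossing P)
    (hs : ∀ x y, P x y → P (antipode _ x) (antipode _ y)) :
    ∃ w, orbitPartition (typeBEmbedding hn w).1 = P := by
  obtain ⟨u, hu, rfl⟩ := exists_belowCyc hP
  have hmem : u ∈ signedPerm n := by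
    rw [mem_signedPerm_iff_conj, hu.conj_eq_iff, ← antipode_eq]
    refine fun x y => ⟨fun h => ?_, hs x y⟩
    simpa only [antipode_antipode] using hs _ _ h
  obtain ⟨v, hv⟩ := exists_typeBEmbedding_eq hn
    (w := ⟨u, absLE_one_left _, belowCyc_iff_absLE.1 hu⟩) hmem
  exact ⟨v, by rw [hv]⟩

theorem exists_isGLB_typeB (hn : 0 < n) (u v : NCGroup (reflB n) (cycB n)) :
    ∃ m, IsGLB {typeBEmbedding hn u, typeBEmbedding hn v} (typeBEmbedding hn m) := by
  obtain ⟨m, hm⟩ := exists_typeB_orbitPartition hn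
    (P := orbitPartition u.1.1 ⊓ orbitPartition v.1.1)
    (fun a b c d h1 h2 h3 hac hbd =>
      ⟨(typeBEmbedding hn u).belowCyc.noncrossing a b c d h1 h2 h3 hac.1 hbd.1,
        (typeBEmbedding hn v).belowCyc.noncrossing a b c d h1 h2 h3 hac.2 hbd.2⟩)
    (fun x y h => ⟨(orbitPartition_antipode u.1 x y).2 h.1,
      (orbitPartition_antipode v.1 x y).2 h.2⟩)
  refine ⟨m, ?_, fun w hw => ?_⟩
  · rintro _ (rfl | rfl) <;> rw [NCGroup.le_iff, hm]
    · exact inf_le_left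
    · exact inf_le_right
  · have h1 := NCGroup.le_iff.1 (hw (Set.mem_insert _ _))
    have h2 := NCGroup.le_iff.1 (hw (Set.mem_insert_of_mem _ rfl))
    rw [NCGroup.le_iff, hm]
    exact le_inf h1 h2

/-- Rotations are not monotone, so the claim is moved to permutations, where rotating is conjugation
by a power of `c` and preserves length. -/
theorem noncrossing_comap_cyc_pow {N : ℕ} {P : Setoid (Fin N)} (hP : Noncrossing P) (m : ℕ) :
    Noncrossing (P.comap (cyc N ^ m)) := by
  obtain ⟨u, hu, rfl⟩ := exists_belowCyc hP
  obtain ⟨l, hl⟩ : ∃ l : ℕ, cyc N ^ l = (cyc N ^ m)⁻¹ := mem_powers_iff_mem_zpowers.2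
    (inv_mem (pow_mem (Subgroup.mem_zpowers (cyc N)) m))
  have h : (orbitPartition u).comap (cyc N ^ m) =
      orbitPartition (cyc N ^ l * u * (cyc N ^ l)⁻¹) := by
    ext x y
    have h2 := orbitPartition_conj (cyc N ^ l) u ((cyc N ^ m) x) ((cyc N ^ m) y)
    rw [Setoid.comap_rel, ← h2, hl]
    simp
  rw [h]
  exact (hu.conj_cyc_pow l).noncrossing

theorem exists_isLUB_typeB (hn : 0 < n) (u v : NCGroup (reflB n) (cycB n)) :
    ∃ j, IsLUB {typeBEmbedding hn u, typeBEmbedding hn v} (typeBEmbedding hn j) := by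
  obtain ⟨j, hj⟩ := exists_typeB_orbitPartition hn
    -- The join is the noncrossing closure. Rotating an upper bound by the half-turn gives another
    -- upper bound, so the infimum is symmetric.
    (P := sInf {Q | Noncrossing Q ∧ orbitPartition u.1.1 ≤ Q ∧ orbitPartition v.1.1 ≤ Q})
    (fun a b c d h1 h2 h3 hac hbd Q hQ => hQ.1 a b c d h1 h2 h3 (hac Q hQ) (hbd Q hQ))
    (fun x y h Q hQ => h (Q.comap (antipode (2 * n)))
      ⟨by rw [antipode_eq]; exact noncrossing_comap_cyc_pow hQ.1 n,
        fun {a b} hab => hQ.2.1 ((orbitPartition_antipode u.1 a b).2 hab),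
        fun {a b} hab => hQ.2.2 ((orbitPartition_antipode v.1 a b).2 hab)⟩)
  refine ⟨j, ?_, fun w hw => ?_⟩
  · rintro _ (rfl | rfl) <;> rw [NCGroup.le_iff, hj] <;> refine le_sInf fun Q hQ => ?_
    · exact hQ.2.1
    · exact hQ.2.2
  · have h1 := NCGroup.le_iff.1 (hw (Set.mem_insert _ _))
    have h2 := NCGroup.le_iff.1 (hw (Set.mem_insert_of_mem _ rfl))
    rw [NCGroup.le_iff, hj]
    exact sInf_le ⟨w.belowCyc.noncrossing, h1, h2⟩

theorem delta_reflB_coe (π : NCGroupDiv (reflB n) (cycB n) k) (i : Fin k) :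
    (delta π i).1 = deltaPerm (fun i => (π.1 i).1.1) i := by
  rw [delta, deltaPerm, nextPerm]
  split_ifs <;> rfl

/-- The order on multichains compares deltas, so these too must lie where the orders of types A and
B agree. -/
theorem nearlyPaired_delta (hn : 0 < n) (π : NCGroupDiv (reflB n) (cycB n) k) (i : Fin k) :
    NearlyPaired (delta π i) := by
  rw [delta]
  split_ifs with h
  · exact (((π.1 _).nearlyPaired hn).split (π.2 _ _ (Fin.le_def.2 (Nat.le_succ _)))).2.2
  · exact ((nearlyPaired_cycB hn).split (π.1 i).2.2).2.2

/-- The embedding of `NC^{(k)}(B_n)` into `NC^{(k)}(A_{2n-1})`. -/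
def typeBDivEmbedding (hn : 0 < n) (k : ℕ) :
    NCGroupDiv (reflB n) (cycB n) k ↪o NCGroupDiv (reflA (2 * n)) (cyc (2 * n)) k where
  toFun π := ⟨fun i => typeBEmbedding hn (π.1 i),
    fun i j hij => (typeBEmbedding hn).map_rel_iff.2 (π.2 i j hij)⟩
  inj' π μ h := Subtype.ext (funext fun i =>
    (typeBEmbedding hn).injective (congrFun (congrArg Subtype.val h) i))
  map_rel_iff' {π μ} := by
    refine forall_congr' fun i => ?_
    rw [absLE_reflB_iff (nearlyPaired_delta hn π i), delta_reflB_coe, delta_reflB_coe]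
    rfl

theorem range_typeBDivEmbedding (hn : 0 < n) :
    Set.range (typeBDivEmbedding hn k) = {π | ∀ i, π.1 i ∈ Set.range (typeBEmbedding hn)} := by
  ext π
  constructor
  · rintro ⟨π, rfl⟩ i
    exact ⟨π.1 i, rfl⟩
  · intro h
    choose μ hμ using h
    refine ⟨⟨μ, fun i j hij => (typeBEmbedding hn).map_rel_iff.1 ?_⟩, Subtype.ext (funext hμ)⟩
    rw [hμ, hμ]
    exact π.2 i j hij

theorem isMultichain_coe {N : ℕ} (π : NCGroupDiv (reflA N) (cyc N) k) :
    IsMultichain fun i => (π.1 i).1 :=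
  ⟨fun i => (π.1 i).belowCyc, fun i j hij => absLE_reflA.1 (π.2 i j hij)⟩

theorem noncrossing_shuffleDelta {N : ℕ} (hN : 0 < N) (hk : 0 < k)
    (π : NCGroupDiv (reflA N) (cyc N) k) : Noncrossing (shuffleDelta π) := by
  have h := isMultichain_coe π
  rw [shuffleDelta, h.shuffleFin_eq]
  exact ((isMultichain_iff hN hk _).1 h).inv_mul_cyc.noncrossing

theorem nabla_eq {N : ℕ} (hN : 0 < N) (hk : 0 < k) (π : NCGroupDiv (reflA N) (cyc N) k) :
    nabla π = orbitPartition (nablaPerm fun i => (π.1 i).1) := by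
  have h := isMultichain_coe π
  rw [nabla, shuffleDelta, h.shuffleFin_eq, ((isMultichain_iff hN hk _).1 h).krewerasInv_eq]

theorem centrallySymmetric_nablaPerm_iff {π : Fin k → Equiv.Perm (Fin (2 * n))}
    (h : BelowCyc (nablaPerm π)) :
    CentrallySymmetric (orbitPartition (nablaPerm π)) ↔ ∀ i, π i ∈ signedPerm n := by
  have h1 : antipode (2 * n * k) = cyc (2 * n * k) ^ (k * n) := by
    have : 2 * n * k / 2 = k * n := by
      rw [mul_assoc, Nat.mul_div_cancel_left _ two_pos, mul_comm]
    rw [antipode, this]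
    rfl
  rw [CentrallySymmetric, h1, ← h.conj_eq_iff, mul_inv_eq_iff_eq_mul, ← commute_iff_eq,
    commute_nablaPerm_iff]
  simp only [mem_signedPerm, antipode_eq]

/-- The restriction of the type `A` map to `NC^{(k)}(B_n)`. -/
noncomputable def typeBMap (hn : 0 < n) (hk : 0 < k) (π : NCGroupDiv (reflB n) (cycB n) k) :
    NCSymDiv n k :=
  ⟨nabla (typeBDivEmbedding hn k π), by
    have hN : 0 < 2 * n := by omega
    have h := (isMultichain_iff hN hk _).1 (isMultichain_coe (typeBDivEmbedding hn k π))
    rw [nabla_eq hN hk]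
    exact ⟨h.noncrossing, (centrallySymmetric_nablaPerm_iff h).2 fun i => (π.1 i).1.2,
      divisible_nablaPerm _⟩⟩

theorem typeBMap_le_iff (hn : 0 < n) (hk : 0 < k) {π μ : NCGroupDiv (reflB n) (cycB n) k} :
    typeBMap hn hk π ≤ typeBMap hn hk μ ↔ π ≤ μ := by
  have hN : 0 < 2 * n := by omega
  rw [← (typeBDivEmbedding hn k).map_rel_iff, ← Subtype.coe_le_coe]
  change nabla _ ≤ nabla _ ↔ _
  rw [nabla_eq hN hk, nabla_eq hN hk, orbitPartition_nablaPerm_le_iff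
    ((isMultichain_iff hN hk _).1 (isMultichain_coe _))
    ((isMultichain_iff hN hk _).1 (isMultichain_coe _))]
  rfl

theorem typeBMap_bijective (hn : 0 < n) (hk : 0 < k) :
    Function.Bijective (typeBMap (n := n) (k := k) hn hk) := by
  have hN : 0 < 2 * n := by omega
  constructor
  · intro π μ h
    have h1 : nabla _ = nabla _ := congrArg Subtype.val h
    rw [nabla_eq hN hk, nabla_eq hN hk] at h1
    -- The chain is recovered in three steps: the orbits determine the permutation, it determines
    -- the stacked deltas, and these determine the entries.
    have h2 := ((isMultichain_iff hN hk _).1 (isMultichain_coe _)).eq_of_orbitPartition_eq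
      ((isMultichain_iff hN hk _).1 (isMultichain_coe _)) h1
    have h3 := stack_injective (inv_injective (mul_left_cancel h2))
    have h4 := deltaPerm_injective h3
    exact (typeBDivEmbedding hn k).injective
      (Subtype.ext (funext fun i => Subtype.ext (congrFun h4 i)))
  · rintro ⟨P, hP, hs, hd⟩
    obtain ⟨π, hπ, rfl⟩ := exists_nablaPerm hP hd
    have h1 := (isMultichain_iff hN hk _).2 hπ
    have h2 := (centrallySymmetric_nablaPerm_iff hπ).1 hs
    refine ⟨⟨fun i => ⟨⟨π i, h2 i⟩, absLE_reflB_one_left _, (absLE_cycB_iff hn).2 (h1.1 i)⟩,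
      fun i j hij => absLE_reflB_of_reflA (absLE_reflA.2 (h1.2 i j hij))⟩, Subtype.ext ?_⟩
    exact nabla_eq hN hk _

end SymmetricNC

end KDiv

open KDiv
theorem mainTheorem10 (n k : ℕ) (hn : 0 < n) (hk : 0 < k) :
    -- `NC(B_n)` is the sublattice of `NC(A_{2n-1})` fixed under conjugation by `c ^ n`
    ∃ ι : NCGroup (reflB n) (cycB n) ↪o NCGroup (reflA (2 * n)) (cyc (2 * n)),
      (∀ w, (ι w).1 = (w.1 : Equiv.Perm (Fin (2 * n)))) ∧
      (Set.range ι = {w | cyc (2 * n) ^ n * w.1 * (cyc (2 * n) ^ n)⁻¹ = w.1}) ∧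
      (∀ u v, ∃ m j, IsGLB {ι u, ι v} (ι m) ∧ IsLUB {ι u, ι v} (ι j)) ∧
    -- correspondingly, `NC^{(k)}(B_n)` is an induced subposet of `NC^{(k)}(A_{2n-1})`
    ∃ ιk : NCGroupDiv (reflB n) (cycB n) k ↪o NCGroupDiv (reflA (2 * n)) (cyc (2 * n)) k,
      (∀ π i, (ιk π).1 i = ι (π.1 i)) ∧
      (Set.range ιk = {π | ∀ i, π.1 i ∈ Set.range ι}) ∧
    -- the restriction of the type `A` map is an isomorphism
    ∃ Φ : NCGroupDiv (reflB n) (cycB n) k ≃o NCSymDiv n k,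
      ∀ π, Noncrossing (shuffleDelta (ιk π)) ∧ (Φ π).1 = nabla (ιk π) := by
  refine ⟨typeBEmbedding hn, typeBEmbedding_coe hn, Set.ext fun w => mem_range_typeBEmbedding hn,
    fun u v => ?_, typeBDivEmbedding hn k, fun _ _ => rfl, range_typeBDivEmbedding hn,
    ⟨Equiv.ofBijective _ (typeBMap_bijective hn hk), typeBMap_le_iff hn hk⟩, fun π =>
      ⟨noncrossing_shuffleDelta (by omega) hk _, rfl⟩⟩
  obtain ⟨m, hm⟩ := exists_isGLB_typeB hn u v
  obtain ⟨j, hj⟩ := exists_isLUB_typeB hn u v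
  exact ⟨m, j, hm, hj⟩
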